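/- Let $p$ be an odd prime and let $k \ge 1$ be an integer. Let $W_k = C_p \wr C_{p^k} = B_k \rtimes \langle \dot x_k\rangle$ be the regular wreath product, with top group $\langle \dot x_k\rangle \cong C_{p^k}$ and base group $B_k = \prod_{j=0}^{p^k-1}\langle \dot y_k^{\,\dot x_k^{\,j}}\rangle \cong C_p^{\,p^k}$. Let $F$ be the free pro-$p$ group on two generators $\tilde x, \tilde y$, let $\eta_k\colon F\to W_k$ be the continuous epimorphism with $\tilde x\mapsto \dot x_k$, $\tilde y\mapsto\dot y_k$, and put $R_k=\ker\eta_k$, $Y_k=\eta_k^{-1}(B_k)$. Define $$G_k = F/N_k,\qquad N_k = [R_k,Y_k]\,Y_k^{\,p}\,\langle \tilde x^{\,p^k}\rangle^F,$$ where all subgroups of $F$ are understood to be closed, $Y_k^{\,p}$ is the subgroup generated by all $p$-th powers of elements of $Y_k$, and $\langle \tilde x^{\,p^k}\rangle^F$ is the normal closure. Let $x_k,y_k$ be the images of $\tilde x,\tilde y$ in $G_k$. With $[a,b]=a^{-1}b^{-1}ab$ and left-normed iterated commutators, put, for $i,j\ge 1$, $$c_i=[y_k,\underbrace{x_k,\ldots,x_k}_{i-1}],\qquad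 c_{i,j}=[c_i,y_k,\underbrace{x_k,\ldots,x_k}_{j-1}],$$ so that $c_1=y_k$ and $c_{i,1}=[c_i,y_k]$. Let $\gamma_1(G_k)=G_k$ and $\gamma_{i+1}(G_k)=[\gamma_i(G_k),G_k]$. Then $G_k$ is nilpotent of class exactly $2p^k-1$, and its lower central series is as follows. First, $$\gamma_1(G_k)=G_k=\langle x_k,y_k\rangle\,\gamma_2(G_k)\quad\text{with}\quad G_k/\gamma_2(G_k)\cong C_{p^k}\times C_p.$$ For $2\le i\le p^k$ with $i$ even, $$\gamma_i(G_k)=\langle c_i,\,c_{2,i-2},\,c_{4,i-4},\ldots,c_{i-2,2}\rangle\,\gamma_{i+1}(G_k),\qquad \gamma_i(G_k)/\gamma_{i+1}(G_k)\cong C_p^{\,i/2};$$ for $2\le i\le p^k$ with $i$ odd, $$\gamma_i(G_k)=\langle c_i,\,c_{2,i-2},\,c_{4,i-4},\ldots,c_{i-1,1}\rangle\,\gamma_{i+1}(G_k),\qquad \gamma_i(G_k)/\gamma_{i+1}(G_k)\cong C_p^{\,(i+1)/2};$$ for $p^k+1\le i\le 2p^k-1$ with $i$ even, $$\gamma_i(G_k)=\langle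 c_{i-p^k+1,\,p^k-1},\,c_{i-p^k+3,\,p^k-3},\ldots,c_{p^k-1,\,i-p^k+1}\rangle\,\gamma_{i+1}(G_k),\qquad \gamma_i(G_k)/\gamma_{i+1}(G_k)\cong C_p^{\,(2p^k-i)/2};$$ for $p^k+1\le i\le 2p^k-1$ with $i$ odd, $$\gamma_i(G_k)=\langle c_{i-p^k,\,p^k},\,c_{i-p^k+2,\,p^k-2},\ldots,c_{p^k-1,\,i-p^k+1}\rangle\,\gamma_{i+1}(G_k),\qquad \gamma_i(G_k)/\gamma_{i+1}(G_k)\cong C_p^{\,(2p^k-i+1)/2}.$$ (In each list the first index of $c_{m,n}$ runs through consecutive even numbers; for $i=2$ the list consists of $c_2$ only.) -/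

import Mathlib

/-! ### The free pro-`p` group on two generators

It is built as the pro-`p` completion of the discrete free group of rank two: the inverse limit of
the finite discrete quotients `FreeGroup (Fin 2) ⧸ N`, where `N` runs over the normal subgroups
of `p`-power index. -/

/-- The normal subgroups of `p`-power index of the free group of rank two. -/
def PIndexSubgroup (p : ℕ) : Type :=
  {N : Subgroup (FreeGroup (Fin 2)) // N.Normal ∧ ∃ n : ℕ, N.index = p ^ n}

instance PIndexSubgroup.normal {p : ℕ} (N : PIndexSubgroup p) : N.1.Normal := N.2.1

/-- The finite `p`-quotient of the free group of rank two belonging to `N`,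
with the discrete topology. -/
def PQuotient {p : ℕ} (N : PIndexSubgroup p) : Type := FreeGroup (Fin 2) ⧸ N.1

instance PQuotient.group {p : ℕ} (N : PIndexSubgroup p) : Group (PQuotient N) :=
  inferInstanceAs (Group (FreeGroup (Fin 2) ⧸ N.1))

instance PQuotient.topology {p : ℕ} (N : PIndexSubgroup p) : TopologicalSpace (PQuotient N) := ⊥

instance PQuotient.discrete {p : ℕ} (N : PIndexSubgroup p) : DiscreteTopology (PQuotient N) :=
  ⟨rfl⟩

/-- The projection of the free group of rank two onto one of its finite `p`-quotients. -/
def PQuotient.mk {p : ℕ} (N : PIndexSubgroup p) : FreeGroup (Fin 2) →* PQuotient N :=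
  QuotientGroup.mk' N.1

/-- The transition map between two finite `p`-quotients. -/
def PQuotient.transition {p : ℕ} (M N : PIndexSubgroup p) (h : M.1 ≤ N.1) :
    PQuotient M →* PQuotient N :=
  QuotientGroup.map M.1 N.1 (MonoidHom.id _) h

/-- The inverse limit of the finite `p`-quotients, as a subgroup of their product. -/
def freeProPSubgroup (p : ℕ) : Subgroup (∀ N : PIndexSubgroup p, PQuotient N) where
  carrier := {f | ∀ (M N : PIndexSubgroup p) (h : M.1 ≤ N.1),
    PQuotient.transition M N h (f M) = f N}
  mul_mem' := by
    intro a b ha hb M N h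
    simp only [Pi.mul_apply, map_mul, ha M N h, hb M N h]
  one_mem' := by
    intro M N h
    simp only [Pi.one_apply, map_one]
  inv_mem' := by
    intro a ha M N h
    simp only [Pi.inv_apply, map_inv, ha M N h]

/-- The free pro-`p` group on two generators, a topological group with the topology induced from
the product of the finite discrete quotients. -/
abbrev FreeProP (p : ℕ) : Type := freeProPSubgroup p

/-- The canonical homomorphism from the discrete free group of rank two. -/
def FreeProP.ofFree (p : ℕ) : FreeGroup (Fin 2) →* FreeProP p where
  toFun w := ⟨fun N => PQuotient.mk N w, fun _ _ _ => rfl⟩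
  map_one' := by
    apply Subtype.ext
    funext N
    exact map_one (PQuotient.mk N)
  map_mul' a b := by
    apply Subtype.ext
    funext N
    exact map_mul (PQuotient.mk N) a b

/-- The first free generator `x̃`. -/
def FreeProP.genX (p : ℕ) : FreeProP p := FreeProP.ofFree p (FreeGroup.of 0)

/-- The second free generator `ỹ`. -/
def FreeProP.genY (p : ℕ) : FreeProP p := FreeProP.ofFree p (FreeGroup.of 1)

/-- The kernel of a homomorphism to a finite `p`-group, as a normal subgroup of `p`-power index. -/
def kerPIndex (p : ℕ) [Fact p.Prime] {P : Type} [Group P] [Finite P] (hP : IsPGroup p P)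
    (f : FreeGroup (Fin 2) →* P) : PIndexSubgroup p :=
  ⟨f.ker, inferInstance, by
    obtain ⟨n, hn⟩ := IsPGroup.iff_card.mp (hP.to_subgroup f.range)
    exact ⟨n, by rw [Subgroup.index_ker, hn]⟩⟩

/-- The continuous homomorphism from the free pro-`p` group to a finite `p`-group which maps
`x̃` to `a` and `ỹ` to `b`. -/
def FreeProP.lift (p : ℕ) [Fact p.Prime] {P : Type} [Group P] [Finite P] (hP : IsPGroup p P)
    (a b : P) : FreeProP p →* P :=
  ((QuotientGroup.kerLift (FreeGroup.lift ![a, b]) :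
      PQuotient (kerPIndex p hP (FreeGroup.lift ![a, b])) →* P).comp
    (Pi.evalMonoidHom (fun N : PIndexSubgroup p => PQuotient N)
      (kerPIndex p hP (FreeGroup.lift ![a, b])))).comp (freeProPSubgroup p).subtype

theorem FreeProP.lift_genX (p : ℕ) [Fact p.Prime] {P : Type} [Group P] [Finite P]
    (hP : IsPGroup p P) (a b : P) : FreeProP.lift p hP a b (FreeProP.genX p) = a := by
  change QuotientGroup.kerLift (FreeGroup.lift ![a, b]) (QuotientGroup.mk (FreeGroup.of 0)) = a
  simp

theorem FreeProP.lift_genY (p : ℕ) [Fact p.Prime] {P : Type} [Group P] [Finite P]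
    (hP : IsPGroup p P) (a b : P) : FreeProP.lift p hP a b (FreeProP.genY p) = b := by
  change QuotientGroup.kerLift (FreeGroup.lift ![a, b]) (QuotientGroup.mk (FreeGroup.of 1)) = b
  simp

theorem FreeProP.continuous_lift (p : ℕ) [Fact p.Prime] {P : Type} [Group P] [Finite P]
    [TopologicalSpace P] (hP : IsPGroup p P) (a b : P) : Continuous (FreeProP.lift p hP a b) := by
  have h1 : Continuous fun f : FreeProP p =>
      f.1 (kerPIndex p hP (FreeGroup.lift ![a, b])) :=
    (continuous_apply _).comp continuous_subtype_val
  exact (continuous_of_discreteTopology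
    (f := fun u : PQuotient (kerPIndex p hP (FreeGroup.lift ![a, b])) =>
      (QuotientGroup.kerLift (FreeGroup.lift ![a, b]) : _ → P) u)).comp h1

/-! ### The wreath product `W_k` and the group `G_k` -/

/-- The regular wreath product `W_k` of a cyclic group of order `p` by a cyclic group
of order `p ^ k`. -/
abbrev WreathW (p k : ℕ) : Type :=
  RegularWreathProduct (Multiplicative (ZMod p)) (Multiplicative (ZMod (p ^ k)))

instance WreathW.finite (p k : ℕ) [Fact p.Prime] : Finite (WreathW p k) := by
  have : NeZero (p ^ k) := ⟨pow_ne_zero _ (Fact.out : p.Prime).ne_zero⟩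
  have : Finite (Multiplicative (ZMod p)) := inferInstanceAs (Finite (ZMod p))
  have : Finite (Multiplicative (ZMod (p ^ k))) := inferInstanceAs (Finite (ZMod (p ^ k)))
  infer_instance

theorem WreathW.isPGroup (p k : ℕ) [Fact p.Prime] : IsPGroup p (WreathW p k) := by
  have : NeZero (p ^ k) := ⟨pow_ne_zero _ (Fact.out : p.Prime).ne_zero⟩
  have : Finite (Multiplicative (ZMod (p ^ k))) := inferInstanceAs (Finite (ZMod (p ^ k)))
  have h1 : Nat.card (Multiplicative (ZMod p)) = p := Nat.card_zmod p
  have h2 : Nat.card (Multiplicative (ZMod (p ^ k))) = p ^ k := Nat.card_zmod (p ^ k)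
  refine IsPGroup.of_card (n := p ^ k + k) ?_
  rw [RegularWreathProduct.card, h1, h2, pow_add]

/-- The generator of the top group of `W_k`. -/
def WreathW.dotX (p k : ℕ) : WreathW p k :=
  RegularWreathProduct.inl (Multiplicative.ofAdd (1 : ZMod (p ^ k)))

/-- The element of the base group of `W_k` with a generator in the coordinate of the identity and
trivial entries elsewhere. -/
def WreathW.dotY (p k : ℕ) : WreathW p k :=
  ⟨Pi.mulSingle 1 (Multiplicative.ofAdd (1 : ZMod p)), 1⟩

/-- The base group `B_k`. -/
def WreathW.base (p k : ℕ) : Subgroup (WreathW p k) :=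
  (RegularWreathProduct.rightHom : WreathW p k →* Multiplicative (ZMod (p ^ k))).ker

instance WreathW.base_normal (p k : ℕ) : (WreathW.base p k).Normal :=
  inferInstanceAs (MonoidHom.ker _).Normal

/-- The continuous epimorphism `η_k` from the free pro-`p` group to `W_k`. -/
def etaK (p k : ℕ) [Fact p.Prime] : FreeProP p →* WreathW p k :=
  FreeProP.lift p (WreathW.isPGroup p k) (WreathW.dotX p k) (WreathW.dotY p k)

/-- `R_k`, the kernel of `η_k`. -/
def subR (p k : ℕ) [Fact p.Prime] : Subgroup (FreeProP p) := (etaK p k).ker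

/-- `Y_k`, the preimage of the base group under `η_k`. -/
def subY (p k : ℕ) [Fact p.Prime] : Subgroup (FreeProP p) := (WreathW.base p k).comap (etaK p k)

instance subR_normal (p k : ℕ) [Fact p.Prime] : (subR p k).Normal :=
  inferInstanceAs (MonoidHom.ker _).Normal

instance subY_normal (p k : ℕ) [Fact p.Prime] : (subY p k).Normal :=
  inferInstanceAs (Subgroup.comap _ _).Normal

/-- The subgroup `H ^ n` generated by the `n`-th powers of the elements of `H`. -/
def powSubgroup {G : Type*} [Group G] (H : Subgroup G) (n : ℕ) : Subgroup G :=
  Subgroup.closure {g | ∃ h ∈ H, h ^ n = g}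

instance powSubgroup_normal {G : Type*} [Group G] (H : Subgroup G) [hH : H.Normal] (n : ℕ) :
    (powSubgroup H n).Normal := by
  refine ⟨fun g hg c => ?_⟩
  have key : powSubgroup H n ≤ (powSubgroup H n).comap (MulAut.conj c).toMonoidHom := by
    refine (Subgroup.closure_le _).mpr ?_
    rintro g ⟨h, hh, rfl⟩
    exact Subgroup.subset_closure ⟨c * h * c⁻¹, hH.conj_mem h hh c, conj_pow⟩
  exact key hg

/-- `N_k = [R_k, Y_k] Y_k ^ p ⟨x̃ ^ (p ^ k)⟩ ^ F`, a closed normal subgroup. -/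
def subN (p k : ℕ) [Fact p.Prime] : Subgroup (FreeProP p) :=
  (⁅subR p k, subY p k⁆ ⊔ powSubgroup (subY p k) p ⊔
    Subgroup.normalClosure {FreeProP.genX p ^ p ^ k}).topologicalClosure

instance subN_normal (p k : ℕ) [Fact p.Prime] : (subN p k).Normal :=
  Subgroup.is_normal_topologicalClosure _

/-- The group `G_k = F / N_k`. -/
abbrev GroupG (p k : ℕ) [Fact p.Prime] : Type := FreeProP p ⧸ subN p k

/-- `x_k`, the image of `x̃` in `G_k`. -/
def GroupG.x (p k : ℕ) [Fact p.Prime] : GroupG p k := QuotientGroup.mk (FreeProP.genX p)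

/-- `y_k`, the image of `ỹ` in `G_k`. -/
def GroupG.y (p k : ℕ) [Fact p.Prime] : GroupG p k := QuotientGroup.mk (FreeProP.genY p)

/-! ### Commutators and the lower central series -/

/-- The commutator `[a, b] = a⁻¹ b⁻¹ a b`. -/
def rcomm {G : Type*} [Group G] (a b : G) : G := a⁻¹ * b⁻¹ * a * b

/-- The left-normed commutator `[a, b, …, b]` with `n` entries `b`. -/
def iterComm {G : Type*} [Group G] (a b : G) : ℕ → G
  | 0 => a
  | n + 1 => rcomm (iterComm a b n) b

/-- `c_i = [y_k, x_k, …, x_k]` with `i - 1` entries `x_k`, for `i ≥ 1`; thus `c_1 = y_k`. -/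
def GroupG.c (p k : ℕ) [Fact p.Prime] (i : ℕ) : GroupG p k :=
  iterComm (GroupG.y p k) (GroupG.x p k) (i - 1)

/-- `c_{i,j} = [c_i, y_k, x_k, …, x_k]` with `j - 1` entries `x_k`, for `i, j ≥ 1`. -/
def GroupG.cc (p k : ℕ) [Fact p.Prime] (i j : ℕ) : GroupG p k :=
  iterComm (rcomm (GroupG.c p k i) (GroupG.y p k)) (GroupG.x p k) (j - 1)

/-- The `i`-th term `γ_i(G)` of the lower central series, numbered from `γ_1(G) = G`, for
`i ≥ 1`. -/
abbrev gammaTerm (G : Type*) [Group G] (i : ℕ) : Subgroup G :=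
  (⊤ : Subgroup G).lowerCentralSeries (i - 1)

/-- The factor `γ_i(G) / γ_{i+1}(G)` of the lower central series, for `i ≥ 1`. -/
abbrev gammaFactor (G : Type*) [Group G] (i : ℕ) : Type _ :=
  gammaTerm G i ⧸ (gammaTerm G (i + 1)).subgroupOf (gammaTerm G i)

/-- The group `G` is elementary abelian of rank `r`, that is, isomorphic to `C_p ^ r`. -/
def IsElemAbelianOfRank (p : ℕ) (G : Type*) [Group G] (r : ℕ) : Prop :=
  Nonempty (G ≃* (Fin r → Multiplicative (ZMod p)))

/-! Write q = p^k. The image of Y_k in G_k has exponent p, and class at most two because [Y_k, Y_k]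
≤ R_k. This suggests that G_k is C_q acting on the free class-two exponent-p group over V =
F_p[C_q], that is, on V × Λ²V with product (v, w)(v', w') = (v + v', w + w' + ½ v ∧ v'); the ½
exists because p is odd. `Model` is this group, with Λ²V realised as alternating matrices.

The relators of G_k die in the model, because W_k maps to V ⋊ C_q compatibly
(`subN_le_ker_toModel`). Conversely, the relations alone bound the order by q · p^q · p^(q(q-1)/2),
the order of the model (`exists_surjective_of_generators`). Hence G_k is isomorphic to the model
(`GroupG.toModel_bijective`).

In a basis e_0, …, e_{q-1} of V on which commutation with x is the shift, c_i is e_{i-1} modulo Λ²V,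
and c_{m,j} = θ^{j-1}(e_{m-1} ∧ e_0), where θ is the corresponding operator on Λ²V. For i ≥ 2, γ_i
consists of the pairs whose V-part has indices ≥ i-1 and whose Λ²-part has index sums ≥ i-2
(`Model.gammaTerm_eq`).

What remains is linear algebra in a single degree n = i-2 of Λ²V. To leading order θ is a
derivation, so modulo its image e_{a+1} ∧ e_b = -e_a ∧ e_{b+1}: all wedges of one degree agree up to
sign, and in even degree they vanish with e_m ∧ e_m. Thus one new generator e_n ∧ e_0 is needed in
each odd degree (`altFil_le_span_sup`), which is why the first index of c_{m,j} is even. The ranks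
count pairs a < b < q with a + b = i-2, plus one for e_{i-1} while i ≤ q. The last such degree is
2q-3, whence class 2q-1. -/

/-! ### Extensions of a module by an alternating form -/

/-- The homomorphism from the cyclic group of order `n` sending the generator to `u`,
where `u ^ n = 1`. -/
def zmodPowHom {N : Type*} [Monoid N] (n : ℕ) [NeZero n] (u : N) (hu : u ^ n = 1) :
    Multiplicative (ZMod n) →* N where
  toFun z := u ^ (z.toAdd).val
  map_one' := by simp
  map_mul' a b := by
    rw [toAdd_mul, ZMod.val_add, ← pow_add, ← pow_eq_pow_mod _ hu]

theorem zmodPowHom_apply {N : Type*} [Monoid N] (n : ℕ) [NeZero n] (u : N) (hu : u ^ n = 1)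
    (z : Multiplicative (ZMod n)) : zmodPowHom n u hu z = u ^ (z.toAdd).val := rfl

theorem zmodPowHom_ofAdd_one {N : Type*} [Monoid N] (n : ℕ) [NeZero n] (u : N) (hu : u ^ n = 1) :
    zmodPowHom n u hu (Multiplicative.ofAdd 1) = u := by
  rw [zmodPowHom_apply, toAdd_ofAdd]
  obtain h | h := Nat.lt_or_ge 1 n
  · have : Fact (1 < n) := ⟨h⟩
    rw [ZMod.val_one, pow_one]
  · have h1 : n = 1 := le_antisymm h (NeZero.one_le)
    subst h1
    rw [pow_one] at hu
    simp [hu]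

/-- An alternating bilinear form on a module, invariant under the action of a group. -/
structure AlternatingAction (F Q V L : Type*) [CommRing F] [Group Q] [AddCommGroup V] [Module F V]
    [AddCommGroup L] [Module F L] where
  rho : Q →* Module.End F V
  sigma : Q →* Module.End F L
  form : V →ₗ[F] V →ₗ[F] L
  form_self : ∀ v, form v v = 0
  sigma_form : ∀ g v v', sigma g (form v v') = form (rho g v) (rho g v')
  half : F
  half_add_half : half + half = 1

section

open scoped commutatorElement

variable {F Q V L : Type*} [CommRing F] [Group Q] [AddCommGroup V] [Module F V]
    [AddCommGroup L] [Module F L]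

/-- The semidirect product of `Q` with the group of nilpotency class at most two on `V × L` which
belongs to the alternating form. -/
@[ext]
structure FormExt (D : AlternatingAction F Q V L) where
  fst : V
  snd : L
  top : Q

namespace FormExt

variable {D : AlternatingAction F Q V L}

theorem form_swap (v w : V) : D.form v w = - D.form w v := by
  have h := D.form_self (v + w)
  simp only [map_add, LinearMap.add_apply, D.form_self, zero_add, add_zero] at h
  rw [eq_neg_iff_add_eq_zero, add_comm]
  exact h

theorem half_smul_two (l : L) : D.half • l + D.half • l = l := by
  rw [← add_smul, D.half_add_half, one_smul]

/-- Since the form is alternating, the half-form cocycle vanishes on multiples of one vector.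
Inverses and powers of elements with trivial top are therefore componentwise, which gives exponent
p. -/
instance : Mul (FormExt D) where
  mul a b := ⟨a.fst + D.rho a.top b.fst,
    a.snd + D.sigma a.top b.snd + D.half • D.form a.fst (D.rho a.top b.fst), a.top * b.top⟩

instance : One (FormExt D) := ⟨⟨0, 0, 1⟩⟩

instance : Inv (FormExt D) where
  inv a := ⟨-D.rho a.top⁻¹ a.fst, -D.sigma a.top⁻¹ a.snd, a.top⁻¹⟩

@[simp] theorem mul_fst (a b : FormExt D) : (a * b).fst = a.fst + D.rho a.top b.fst := rfl
@[simp] theorem mul_snd (a b : FormExt D) : (a * b).snd =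
    a.snd + D.sigma a.top b.snd + D.half • D.form a.fst (D.rho a.top b.fst) := rfl
@[simp] theorem mul_top (a b : FormExt D) : (a * b).top = a.top * b.top := rfl
@[simp] theorem one_fst : (1 : FormExt D).fst = 0 := rfl
@[simp] theorem one_snd : (1 : FormExt D).snd = 0 := rfl
@[simp] theorem one_top : (1 : FormExt D).top = 1 := rfl
@[simp] theorem inv_fst (a : FormExt D) : a⁻¹.fst = -D.rho a.top⁻¹ a.fst := rfl
@[simp] theorem inv_snd (a : FormExt D) : a⁻¹.snd = -D.sigma a.top⁻¹ a.snd := rfl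
@[simp] theorem inv_top (a : FormExt D) : a⁻¹.top = a.top⁻¹ := rfl

instance : Group (FormExt D) where
  mul_assoc a b c := by
    ext
    · simp [add_assoc]
    · simp [D.sigma_form, smul_add]
      abel
    · simp [mul_assoc]
  one_mul a := by ext <;> simp
  mul_one a := by ext <;> simp
  inv_mul_cancel a := by
    ext
    · simp
    · simp [D.form_self]
    · simp

instance [Finite V] [Finite L] [Finite Q] : Finite (FormExt D) :=
  Finite.of_injective (fun a : FormExt D => (a.fst, a.snd, a.top)) fun a b h => by
    simp only [Prod.mk.injEq] at h
    exact FormExt.ext h.1 h.2.1 h.2.2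

/-- The projection onto the top group. -/
def topHom (D : AlternatingAction F Q V L) : FormExt D →* Q where
  toFun := FormExt.top
  map_one' := rfl
  map_mul' _ _ := rfl

/-- The embedding of the module `L`. -/
def sndHom (D : AlternatingAction F Q V L) : Multiplicative L →* FormExt D where
  toFun l := ⟨0, l.toAdd, 1⟩
  map_one' := rfl
  map_mul' a b := by ext <;> simp

/-- The two orders of multiplication differ by half the form minus half the swapped form, and these
add up to the full form. -/
theorem rcomm_of_top_eq_one (v v' : V) (w w' : L) :
    rcomm (⟨v, w, 1⟩ : FormExt D) ⟨v', w', 1⟩ = ⟨0, D.form v v', 1⟩ := by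
  ext
  · simp [rcomm]
  · simp [rcomm, D.form_self, form_swap v' v]
    refine Eq.trans ?_ (half_smul_two (D := D) (D.form v v'))
    abel
  · simp [rcomm]

theorem rcomm_top (v : V) (w : L) (g : Q) :
    rcomm (⟨v, w, 1⟩ : FormExt D) ⟨0, 0, g⟩ =
      ⟨D.rho g⁻¹ v - v, D.sigma g⁻¹ w - w - D.half • D.form v (D.rho g⁻¹ v), 1⟩ := by
  ext
  · simp [rcomm]; abel
  · simp [rcomm]; abel
  · simp [rcomm]

theorem pow_of_top_eq_one (v : V) (w : L) (n : ℕ) :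
    (⟨v, w, 1⟩ : FormExt D) ^ n = ⟨n • v, n • w, 1⟩ := by
  induction n with
  | zero => simp; rfl
  | succ n ih =>
    rw [pow_succ, ih]
    ext
    · simp [add_smul]
    · simp [add_smul, D.form_self]
    · simp

theorem pow_of_fst_snd_eq_zero (g : Q) (n : ℕ) :
    (⟨0, 0, g⟩ : FormExt D) ^ n = ⟨0, 0, g ^ n⟩ := by
  induction n with
  | zero => simp; rfl
  | succ n ih =>
    rw [pow_succ, ih]
    ext <;> simp [pow_succ]

theorem commutatorElement_of_top_eq_one (v : V) (w : L) (h : FormExt D) :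
    ⁅(⟨v, w, 1⟩ : FormExt D), h⁆ = ⟨v - D.rho h.top v, w - D.sigma h.top w +
      D.half • D.form v h.fst - D.half • D.form h.fst (D.rho h.top v)
        - D.half • D.form (v - D.rho h.top v) (h.fst + D.rho h.top v), 1⟩ := by
  -- Verifying `a * h = c * (h * a)` avoids expanding any inverse.
  have key : (⟨v, w, 1⟩ : FormExt D) * h = ⟨v - D.rho h.top v, w - D.sigma h.top w +
      D.half • D.form v h.fst - D.half • D.form h.fst (D.rho h.top v)
        - D.half • D.form (v - D.rho h.top v) (h.fst + D.rho h.top v), 1⟩ *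
        (h * ⟨v, w, 1⟩) := by
    ext
    · simp
    · simp; abel
    · simp
  rw [commutatorElement_def, key]
  group

end FormExt

end

/-! ### Alternating matrices and the shift -/

section

open Matrix

/-- The alternating matrices of size `q` (the characteristic being odd). -/
def AltMat (p q : ℕ) : Submodule (ZMod p) (Matrix (Fin q) (Fin q) (ZMod p)) where
  carrier := {w | wᵀ = -w}
  add_mem' {a b} ha hb := by
    simp only [Set.mem_ofPred_eq] at *
    rw [transpose_add, ha, hb, neg_add]
  zero_mem' := by simp
  smul_mem' c a ha := by
    simp only [Set.mem_ofPred_eq] at *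
    rw [transpose_smul, ha, smul_neg]

/-- The `a`-th unit vector, which is zero for `a ≥ q`. -/
def unitVec (p q : ℕ) (a : ℕ) : Fin q → ZMod p := fun i => if (i : ℕ) = a then 1 else 0

/-- The nilpotent shift matrix. -/
def shiftMat (p q : ℕ) : Matrix (Fin q) (Fin q) (ZMod p) :=
  of fun i j => if (i : ℕ) = j + 1 then 1 else 0

variable {p q : ℕ}

theorem AltMat.apply_swap (w : AltMat p q) (i j : Fin q) : w.1 i j = -w.1 j i :=
  congrFun (congrFun w.2 j) i

theorem unitVec_eq_zero {a : ℕ} (h : q ≤ a) : unitVec p q a = 0 := by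
  funext i
  have := i.2
  simp only [unitVec, Pi.zero_apply, ite_eq_right_iff]
  omega

theorem unitVec_val (i : Fin q) : unitVec p q i = Pi.single i 1 := by
  funext j
  simp [unitVec, Pi.single_apply, Fin.ext_iff]

theorem sum_smul_unitVec (v : Fin q → ZMod p) : v = ∑ i, v i • unitVec p q i := by
  simp_rw [unitVec_val]
  exact pi_eq_sum_univ' v

theorem shiftMat_mulVec (a : ℕ) : shiftMat p q *ᵥ unitVec p q a = unitVec p q (a + 1) := by
  funext i
  rcases lt_or_ge a q with h | h
  · rw [show unitVec p q a = Pi.single ⟨a, h⟩ 1 from unitVec_val ⟨a, h⟩, mulVec_single_one]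
    rfl
  · rw [unitVec_eq_zero h, unitVec_eq_zero (h.trans (Nat.le_succ a)), mulVec_zero]

theorem shiftMat_pow_mulVec (n a : ℕ) :
    shiftMat p q ^ n *ᵥ unitVec p q a = unitVec p q (a + n) := by
  induction n generalizing a with
  | zero => simp
  | succ n ih => rw [pow_succ, ← mulVec_mulVec, shiftMat_mulVec, ih, add_right_comm, add_assoc]

theorem shiftMat_pow_size : shiftMat p q ^ q = 0 := by
  refine ext_of_mulVec_single fun i => ?_
  rw [← unitVec_val, shiftMat_pow_mulVec, unitVec_eq_zero (Nat.le_add_left _ _), zero_mulVec]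

/-- In characteristic p the cross terms of the power vanish, and so does the q-th power of the
shift. This makes the powers of `1 + shiftMat` an action of the cyclic group of order q: the regular
module in a basis adapted to powers of the augmentation ideal. -/
theorem one_add_shiftMat_pow [Fact p.Prime] {k : ℕ} :
    (1 + shiftMat p (p ^ k)) ^ p ^ k = 1 := by
  rw [(Commute.one_left _).add_pow_prime_pow_eq Fact.out, shiftMat_pow_size, one_pow]
  have : ((p : ℕ) : Matrix (Fin (p ^ k)) (Fin (p ^ k)) (ZMod p)) = 0 := by
    rw [← Matrix.diagonal_natCast]
    simp
  rw [this]
  simp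

/-- The exterior product of two vectors, as an alternating matrix. -/
def wedge (p q : ℕ) : (Fin q → ZMod p) →ₗ[ZMod p] (Fin q → ZMod p) →ₗ[ZMod p] AltMat p q :=
  LinearMap.mk₂ (ZMod p) (fun v w => ⟨vecMulVec v w - vecMulVec w v, by
      change (_ - _)ᵀ = -(_ - _)
      rw [transpose_sub, transpose_vecMulVec, transpose_vecMulVec, neg_sub]⟩)
    (fun u v w => Subtype.ext (by
      change _ = (_ - _) + (_ - _)
      simp only [add_vecMulVec, vecMulVec_add]; abel))
    (fun c v w => Subtype.ext (by
      change _ = c • (_ - _)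
      simp only [smul_vecMulVec, vecMulVec_smul, smul_sub]))
    (fun u v w => Subtype.ext (by
      change _ = (_ - _) + (_ - _)
      simp only [add_vecMulVec, vecMulVec_add]; abel))
    (fun c v w => Subtype.ext (by
      change _ = c • (_ - _)
      simp only [smul_vecMulVec, vecMulVec_smul, smul_sub]))

theorem wedge_apply (v w : Fin q → ZMod p) (i j : Fin q) :
    (wedge p q v w).1 i j = v i * w j - w i * v j := rfl

theorem wedge_self (v : Fin q → ZMod p) : wedge p q v v = 0 :=
  Subtype.ext (sub_self _)

/-- The action of a matrix on alternating matrices by congruence. -/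
def congruence (p q : ℕ) : Matrix (Fin q) (Fin q) (ZMod p) →* Module.End (ZMod p) (AltMat p q) where
  toFun P :=
    { toFun := fun w => ⟨P * w.1 * Pᵀ, by
        change (_)ᵀ = -_
        rw [transpose_mul, transpose_mul, transpose_transpose, show w.1ᵀ = -w.1 from w.2]
        simp [Matrix.mul_assoc]⟩
      map_add' := fun v w => Subtype.ext (by
        change P * (v.1 + w.1) * Pᵀ = P * v.1 * Pᵀ + P * w.1 * Pᵀ
        rw [Matrix.mul_add, Matrix.add_mul])
      map_smul' := fun c w => Subtype.ext (by
        change P * (c • w.1) * Pᵀ = c • (P * w.1 * Pᵀ)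
        rw [Matrix.mul_smul, Matrix.smul_mul]) }
  map_one' := by
    ext w : 2
    change 1 * w.1 * 1ᵀ = w.1
    simp
  map_mul' P P' := by
    ext w : 2
    change P * P' * w.1 * (P * P')ᵀ = P * (P' * w.1 * P'ᵀ) * Pᵀ
    simp only [transpose_mul, Matrix.mul_assoc]

theorem congruence_wedge (P : Matrix (Fin q) (Fin q) (ZMod p)) (v w : Fin q → ZMod p) :
    congruence p q P (wedge p q v w) = wedge p q (P *ᵥ v) (P *ᵥ w) := by
  refine Subtype.ext ?_
  change P * (vecMulVec v w - vecMulVec w v) * Pᵀ = vecMulVec _ _ - vecMulVec _ _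
  rw [Matrix.mul_sub, Matrix.sub_mul, mul_vecMulVec, mul_vecMulVec, vecMulVec_mul, vecMulVec_mul,
    vecMul_transpose, vecMul_transpose]

/-- The exterior product of two unit vectors. -/
def unitWedge (p q : ℕ) (a b : ℕ) : AltMat p q := wedge p q (unitVec p q a) (unitVec p q b)

theorem unitWedge_self (a : ℕ) : unitWedge p q a a = 0 := wedge_self _

theorem unitWedge_eq_zero_left {a : ℕ} (b : ℕ) (h : q ≤ a) : unitWedge p q a b = 0 := by
  rw [unitWedge, unitVec_eq_zero h, map_zero, LinearMap.zero_apply]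

theorem unitWedge_apply (a b : ℕ) (i j : Fin q) :
    (unitWedge p q a b).1 i j = (if (i : ℕ) = a ∧ (j : ℕ) = b then 1 else 0) -
      (if (i : ℕ) = b ∧ (j : ℕ) = a then 1 else 0) := by
  simp only [unitWedge, wedge_apply, unitVec, ite_and, mul_ite, mul_one, mul_zero]
  split_ifs <;> simp_all

/-- The operator which subtracts the identity from the action of `1 + shiftMat`. -/
def theta (p q : ℕ) : Module.End (ZMod p) (AltMat p q) := congruence p q (1 + shiftMat p q) - 1

theorem congruence_eq_one_add_theta : congruence p q (1 + shiftMat p q) = 1 + theta p q := by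
  rw [theta, add_sub_cancel]

theorem theta_apply (w : AltMat p q) :
    theta p q w = congruence p q (1 + shiftMat p q) w - w := rfl

/-- The first two terms are those of a derivation raising the index sum by one; the third lies one
degree higher and is invisible in the graded argument. -/
theorem theta_unitWedge (a b : ℕ) : theta p q (unitWedge p q a b) =
    unitWedge p q (a + 1) b + unitWedge p q a (b + 1) + unitWedge p q (a + 1) (b + 1) := by
  rw [theta_apply, unitWedge, congruence_wedge, add_mulVec, add_mulVec, one_mulVec, one_mulVec,
    shiftMat_mulVec, shiftMat_mulVec]
  simp only [map_add, LinearMap.add_apply, unitWedge]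
  abel

/-- The congruence action has q-th power 1, so the same binomial argument applies to it. This bounds
the useful second indices of c_{m,j} by q. -/
theorem theta_pow_size [Fact p.Prime] {k : ℕ} : theta p (p ^ k) ^ p ^ k = 0 := by
  have h : congruence p (p ^ k) (1 + shiftMat p (p ^ k)) ^ p ^ k = 1 := by
    rw [← map_pow, one_add_shiftMat_pow, map_one]
  rw [congruence_eq_one_add_theta, (Commute.one_left _).add_pow_prime_pow_eq Fact.out, one_pow]
    at h
  have h0 : ((p : ℕ) : Module.End (ZMod p) (AltMat p (p ^ k))) = 0 := by
    ext w : 1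
    rw [Module.End.natCast_apply, ← Nat.cast_smul_eq_nsmul (ZMod p), CharP.cast_eq_zero, zero_smul,
      LinearMap.zero_apply]
  rw [h0] at h
  simpa using h

/-! ### Filtrations by index and by index sum -/

/-- The vectors whose entries with index below `n` vanish. -/
def vecFil (p q : ℕ) (n : ℕ) : Submodule (ZMod p) (Fin q → ZMod p) :=
  Submodule.span (ZMod p) {v | ∃ a, n ≤ a ∧ v = unitVec p q a}

/-- The alternating matrices whose entries with index sum below `n` vanish. -/
def altFil (p q : ℕ) (n : ℕ) : Submodule (ZMod p) (AltMat p q) :=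
  Submodule.span (ZMod p) {w | ∃ a b, n ≤ a + b ∧ w = unitWedge p q a b}

theorem unitVec_mem_vecFil {n a : ℕ} (h : n ≤ a) : unitVec p q a ∈ vecFil p q n :=
  Submodule.subset_span ⟨a, h, rfl⟩

theorem unitWedge_mem_altFil {n a b : ℕ} (h : n ≤ a + b) : unitWedge p q a b ∈ altFil p q n :=
  Submodule.subset_span ⟨a, b, h, rfl⟩

theorem mem_vecFil_iff {n : ℕ} {v : Fin q → ZMod p} :
    v ∈ vecFil p q n ↔ ∀ i : Fin q, (i : ℕ) < n → v i = 0 := by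
  constructor
  · intro h
    induction h using Submodule.span_induction with
    | mem v h =>
      obtain ⟨a, ha, rfl⟩ := h
      intro i hi
      simp only [unitVec, ite_eq_right_iff]
      omega
    | zero => simp
    | add x y _ _ hx hy =>
      intro i hi
      simp [hx i hi, hy i hi]
    | smul c x _ hx =>
      intro i hi
      simp [hx i hi]
  · intro h
    rw [sum_smul_unitVec v]
    refine Submodule.sum_mem _ fun i _ => ?_
    rcases lt_or_ge (i : ℕ) n with hi | hi
    · rw [h i hi, zero_smul]
      exact Submodule.zero_mem _
    · exact Submodule.smul_mem _ _ (unitVec_mem_vecFil hi)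

theorem vecFil_antitone : Antitone (vecFil p q) := fun m n h v hv => by
  rw [mem_vecFil_iff] at *
  exact fun i hi => hv i (hi.trans_le h)

theorem vecFil_zero : vecFil p q 0 = ⊤ := by
  rw [eq_top_iff]
  intro v _
  rw [mem_vecFil_iff]
  simp

theorem vecFil_eq_bot {n : ℕ} (h : q ≤ n) : vecFil p q n = ⊥ := by
  rw [eq_bot_iff]
  intro v hv
  rw [mem_vecFil_iff] at hv
  exact funext fun i => hv i (i.2.trans_le h)

theorem two_ne_zero_of_odd [Fact p.Prime] (hp : Odd p) : (2 : ZMod p) ≠ 0 := by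
  have : Fact (2 < p) := ⟨lt_of_le_of_ne (Fact.out : p.Prime).two_le (by
    rintro rfl
    exact absurd hp (by decide))⟩
  exact Ring.two_ne_zero (by rw [ringChar.eq_iff.mpr (ZMod.charP p)]; exact this.out.ne')

theorem AltMat.apply_self [Fact p.Prime] (hp : Odd p) (w : AltMat p q) (i : Fin q) :
    w.1 i i = 0 := by
  have h : (2 : ZMod p) * w.1 i i = 0 := by
    rw [two_mul]
    exact eq_neg_iff_add_eq_zero.mp (AltMat.apply_swap w i i)
  exact (mul_eq_zero.mp h).resolve_left (two_ne_zero_of_odd hp)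

theorem two_smul_eq_sum_unitWedge (w : AltMat p q) :
    (2 : ZMod p) • w = ∑ i, ∑ j, w.1 i j • unitWedge p q i j := by
  refine Subtype.ext (Matrix.ext fun a b => ?_)
  simp only [Submodule.coe_smul, Submodule.coe_sum, Matrix.sum_apply, Matrix.smul_apply,
    unitWedge_apply, smul_eq_mul, mul_sub, Finset.sum_sub_distrib, ← Fin.ext_iff, ite_and,
    mul_ite, mul_one, mul_zero]
  simp [two_mul]
  rw [AltMat.apply_swap w b a, sub_neg_eq_add]

theorem mem_altFil_iff [Fact p.Prime] (hp : Odd p) {n : ℕ} {w : AltMat p q} :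
    w ∈ altFil p q n ↔ ∀ i j : Fin q, (i : ℕ) + j < n → w.1 i j = 0 := by
  constructor
  · intro h
    induction h using Submodule.span_induction with
    | mem v h =>
      obtain ⟨a, b, ha, rfl⟩ := h
      intro i j hi
      rw [unitWedge_apply, if_neg (by omega), if_neg (by omega), sub_zero]
    | zero => intros; rfl
    | add x y _ _ hx hy =>
      intro i j hi
      change x.1 i j + y.1 i j = 0
      rw [hx i j hi, hy i j hi, add_zero]
    | smul c x _ hx =>
      intro i j hi
      change c * x.1 i j = 0
      rw [hx i j hi, mul_zero]
  · intro h
    -- The sum over all ordered pairs counts each unordered pair twice, so it gives 2w, and 2 is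
    -- invertible.
    rw [← Submodule.smul_mem_iff _ (two_ne_zero_of_odd hp), two_smul_eq_sum_unitWedge]
    refine Submodule.sum_mem _ fun i _ => Submodule.sum_mem _ fun j _ => ?_
    rcases lt_or_ge ((i : ℕ) + j) n with hi | hi
    · rw [h i j hi, zero_smul]
      exact Submodule.zero_mem _
    · exact Submodule.smul_mem _ _ (unitWedge_mem_altFil hi)

theorem altFil_antitone : Antitone (altFil p q) := fun m n h => by
  refine Submodule.span_mono ?_
  rintro _ ⟨a, b, hab, rfl⟩
  exact ⟨a, b, h.trans hab, rfl⟩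

theorem altFil_one [Fact p.Prime] (hp : Odd p) : altFil p q 1 = ⊤ := by
  rw [eq_top_iff]
  intro w _
  rw [mem_altFil_iff hp]
  intro i j h
  have : i = j := by ext; omega
  rw [this, AltMat.apply_self hp w]

theorem altFil_zero [Fact p.Prime] (hp : Odd p) : altFil p q 0 = ⊤ :=
  top_le_iff.mp ((altFil_one hp).ge.trans (altFil_antitone zero_le_one))

/-- The diagonal vanishes, and off it the index sum is at most (q-1) + (q-2) = 2q-3. -/
theorem altFil_eq_bot [Fact p.Prime] (hp : Odd p) {n : ℕ} (h : 2 * q - 2 ≤ n) :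
    altFil p q n = ⊥ := by
  rw [eq_bot_iff]
  intro w hw
  rw [mem_altFil_iff hp] at hw
  refine Subtype.ext (Matrix.ext fun i j => ?_)
  rcases eq_or_ne i j with rfl | hij
  · exact AltMat.apply_self hp w i
  · exact hw i j (by have := i.2; have := j.2; have := Fin.val_ne_iff.mpr hij; omega)

theorem theta_mem_altFil {n : ℕ} {w : AltMat p q} (h : w ∈ altFil p q n) :
    theta p q w ∈ altFil p q (n + 1) := by
  induction h using Submodule.span_induction with
  | mem w h =>
    obtain ⟨a, b, hab, rfl⟩ := h
    rw [theta_unitWedge]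
    refine Submodule.add_mem _ (Submodule.add_mem _ ?_ ?_) ?_ <;>
      exact unitWedge_mem_altFil (by omega)
  | zero => rw [map_zero]; exact Submodule.zero_mem _
  | add x y _ _ hx hy => rw [map_add]; exact Submodule.add_mem _ hx hy
  | smul c x _ hx => rw [map_smul]; exact Submodule.smul_mem _ _ hx

theorem shiftMat_mulVec_mem_vecFil {n : ℕ} {v : Fin q → ZMod p} (h : v ∈ vecFil p q n) :
    shiftMat p q *ᵥ v ∈ vecFil p q (n + 1) := by
  induction h using Submodule.span_induction with
  | mem w h =>
    obtain ⟨a, ha, rfl⟩ := h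
    rw [shiftMat_mulVec]
    exact unitVec_mem_vecFil (by omega)
  | zero => rw [mulVec_zero]; exact Submodule.zero_mem _
  | add x y _ _ hx hy => rw [mulVec_add]; exact Submodule.add_mem _ hx hy
  | smul c x _ hx => rw [mulVec_smul]; exact Submodule.smul_mem _ _ hx

theorem wedge_mem_altFil {m n : ℕ} {v w : Fin q → ZMod p} (hv : v ∈ vecFil p q m)
    (hw : w ∈ vecFil p q n) : wedge p q v w ∈ altFil p q (m + n) := by
  induction hv using Submodule.span_induction with
  | mem v h =>
    obtain ⟨a, ha, rfl⟩ := h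
    induction hw using Submodule.span_induction with
    | mem v h =>
      obtain ⟨b, hb, rfl⟩ := h
      exact unitWedge_mem_altFil (by omega)
    | zero => rw [map_zero]; exact Submodule.zero_mem _
    | add x y _ _ hx hy => rw [map_add]; exact Submodule.add_mem _ hx hy
    | smul c x _ hx => rw [map_smul]; exact Submodule.smul_mem _ _ hx
  | zero => rw [map_zero]; exact Submodule.zero_mem _
  | add x y _ _ hx hy => rw [map_add]; exact Submodule.add_mem _ hx hy
  | smul c x _ hx => rw [map_smul]; exact Submodule.smul_mem _ _ hx

/-- Induction on the degree: applying `theta` to generators in degree n gives generators in degree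
n+1, so it suffices to span the cokernel of `theta` between the two graded pieces. That cokernel is
generated by one class, which is zero when n+1 is even. -/
theorem altFil_le_span_sup (n : ℕ) : altFil p q n ≤
    Submodule.span (ZMod p)
      {w | ∃ r j, Odd r ∧ r + j = n ∧ w = (theta p q ^ j) (unitWedge p q r 0)} ⊔
      altFil p q (n + 1) := by
  induction n with
  | zero =>
    refine Submodule.span_le.mpr ?_
    rintro _ ⟨a, b, -, rfl⟩
    rcases Nat.eq_zero_or_pos (a + b) with h | h
    · obtain ⟨rfl, rfl⟩ : a = 0 ∧ b = 0 := by omega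
      rw [unitWedge_self]
      exact Submodule.zero_mem _
    · exact Submodule.mem_sup_right (unitWedge_mem_altFil h)
  | succ n ih =>
    set T := Submodule.span (ZMod p) {w | ∃ r j, Odd r ∧ r + j = n + 1 ∧
      w = (theta p q ^ j) (unitWedge p q r 0)} ⊔ altFil p q (n + 1 + 1) with hT
    have hlow : ∀ a b, a + b = n + 2 → unitWedge p q a b ∈ T := fun a b h =>
      Submodule.mem_sup_right (unitWedge_mem_altFil h.ge)
    have htheta : ∀ w ∈ altFil p q n, theta p q w ∈ T := by
      intro w hw
      have h := Submodule.mem_map_of_mem (f := theta p q) (ih hw)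
      rw [Submodule.map_sup, Submodule.map_span] at h
      refine (sup_le ?_ ?_ : _ ≤ T) h
      · refine Submodule.span_le.mpr ?_
        rintro _ ⟨_, ⟨r, j, hr, hrj, rfl⟩, rfl⟩
        refine Submodule.mem_sup_left (Submodule.subset_span ⟨r, j + 1, hr, by omega, ?_⟩)
        rw [pow_succ', Module.End.mul_apply]
      · rintro _ ⟨w, hw, rfl⟩
        exact Submodule.mem_sup_right (theta_mem_altFil hw)
    -- The quadratic term of `theta` has degree n+2 and can be dropped.
    have hstep : ∀ a b, a + b = n → unitWedge p q (a + 1) b + unitWedge p q a (b + 1) ∈ T := by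
      intro a b h
      have h1 := htheta _ (unitWedge_mem_altFil (p := p) (q := q) h.ge)
      rw [theta_unitWedge] at h1
      exact (Submodule.add_mem_iff_left _ (hlow _ _ (by omega))).mp h1
    -- By `hstep` an index can be moved from one factor to the other at the cost of a sign, so all
    -- wedges of degree n+1 belong to T or none does.
    have hmove : ∀ b a, a + b = n + 1 →
        (unitWedge p q a b ∈ T ↔ unitWedge p q (n + 1) 0 ∈ T) := by
      intro b
      induction b with
      | zero => rintro a rfl; rfl
      | succ b ihb =>
        intro a hab
        rw [← ihb (a + 1) (by omega)]
        have h1 := hstep a b (by omega)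
        constructor
        · intro h
          exact (Submodule.add_mem_iff_left _ h).mp h1
        · intro h
          exact (Submodule.add_mem_iff_right _ h).mp h1
    have htop : unitWedge p q (n + 1) 0 ∈ T := by
      -- In even degree the middle wedge e_m ∧ e_m is zero; in odd degree the wedge with 0 is itself
      -- a listed generator, with j = 0.
      rcases Nat.even_or_odd (n + 1) with ⟨m, hm⟩ | hodd
      · rw [← hmove m m hm.symm, unitWedge_self]
        exact Submodule.zero_mem _
      · exact Submodule.mem_sup_left (Submodule.subset_span ⟨n + 1, 0, hodd, rfl, by simp⟩)
    refine Submodule.span_le.mpr ?_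
    rintro _ ⟨a, b, hab, rfl⟩
    rcases hab.eq_or_lt with h | h
    · exact (hmove b a h.symm).mpr htop
    · exact Submodule.mem_sup_right (unitWedge_mem_altFil h)

end

/-! ### The model of the group -/

theorem Submodule.pow_apply_sub_mem {F V : Type*} [CommRing F] [AddCommGroup V] [Module F V]
    {Fil : ℕ → Submodule F V} (hanti : Antitone Fil) {A : Module.End F V}
    (hA : ∀ n, ∀ v ∈ Fil n, A v - v ∈ Fil (n + 1)) (m n : ℕ) :
    ∀ v ∈ Fil n, (A ^ m) v - v ∈ Fil (n + 1) := by
  intro v hv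
  induction m with
  | zero => simp
  | succ m ih =>
    have h1 : (A ^ m) v ∈ Fil n := by
      simpa using Submodule.add_mem _ (hanti (Nat.le_succ n) ih) hv
    rw [pow_succ', Module.End.mul_apply,
      show A ((A ^ m) v) - v = (A ((A ^ m) v) - (A ^ m) v) + ((A ^ m) v - v) by abel]
    exact Submodule.add_mem _ (hA n _ h1) ih

/-- The action of the cyclic group of order `p ^ k` on vectors and on alternating matrices, through
the powers of `1 + shiftMat`. -/
def modelAction (p k : ℕ) [Fact p.Prime] (hp : Odd p) :
    AlternatingAction (ZMod p) (Multiplicative (ZMod (p ^ k))) (Fin (p ^ k) → ZMod p)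
      (AltMat p (p ^ k)) where
  rho := ((Matrix.toLinAlgEquiv' : Matrix (Fin (p ^ k)) (Fin (p ^ k)) (ZMod p) ≃ₐ[ZMod p] _) :
    Matrix (Fin (p ^ k)) (Fin (p ^ k)) (ZMod p) →* _).comp
      (zmodPowHom (p ^ k) (1 + shiftMat p (p ^ k)) one_add_shiftMat_pow)
  sigma := (congruence p (p ^ k)).comp
    (zmodPowHom (p ^ k) (1 + shiftMat p (p ^ k)) one_add_shiftMat_pow)
  form := wedge p (p ^ k)
  form_self := wedge_self
  sigma_form _ _ _ := congruence_wedge _ _ _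
  half := 2⁻¹
  half_add_half := by
    rw [← two_mul]
    exact mul_inv_cancel₀ (two_ne_zero_of_odd hp)

/-- The model of the group `G_k`. -/
abbrev Model (p k : ℕ) [Fact p.Prime] (hp : Odd p) : Type := FormExt (modelAction p k hp)

section

variable {p k : ℕ} [Fact p.Prime] {hp : Odd p}

/-- The generator of the top group of the model. -/
def Model.x (p k : ℕ) [Fact p.Prime] (hp : Odd p) : Model p k hp :=
  -- The sign makes `rcomm _ x`, which acts through the inverse of the top component, act through `1
  -- + shiftMat` itself.
  ⟨0, 0, Multiplicative.ofAdd (-1)⟩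

/-- The generator of the bottom group of the model. -/
def Model.y (p k : ℕ) [Fact p.Prime] (hp : Odd p) : Model p k hp :=
  ⟨unitVec p (p ^ k) 0, 0, 1⟩

theorem modelAction_rho_sub_mem (g : Multiplicative (ZMod (p ^ k))) {n : ℕ}
    {v : Fin (p ^ k) → ZMod p} (hv : v ∈ vecFil p (p ^ k) n) :
    (modelAction p k hp).rho g v - v ∈ vecFil p (p ^ k) (n + 1) := by
  have h : (modelAction p k hp).rho g =
      (Matrix.toLinAlgEquiv' (1 + shiftMat p (p ^ k)) : Module.End (ZMod p) _) ^ g.toAdd.val :=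
    map_pow Matrix.toLinAlgEquiv' _ _
  rw [h]
  refine Submodule.pow_apply_sub_mem vecFil_antitone (fun n v hv => ?_) _ n v hv
  rw [Matrix.toLinAlgEquiv'_apply, Matrix.add_mulVec, Matrix.one_mulVec, add_sub_cancel_left]
  exact shiftMat_mulVec_mem_vecFil hv

theorem modelAction_sigma_sub_mem (g : Multiplicative (ZMod (p ^ k))) {n : ℕ}
    {w : AltMat p (p ^ k)} (hw : w ∈ altFil p (p ^ k) n) :
    (modelAction p k hp).sigma g w - w ∈ altFil p (p ^ k) (n + 1) := by
  have h : (modelAction p k hp).sigma g =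
      congruence p (p ^ k) (1 + shiftMat p (p ^ k)) ^ g.toAdd.val :=
    map_pow (congruence p (p ^ k)) _ _
  rw [h]
  refine Submodule.pow_apply_sub_mem altFil_antitone (fun n w hw => ?_) _ n w hw
  rw [← theta_apply]
  exact theta_mem_altFil hw

theorem modelAction_rho_mem (g : Multiplicative (ZMod (p ^ k))) {n : ℕ}
    {v : Fin (p ^ k) → ZMod p} (hv : v ∈ vecFil p (p ^ k) n) :
    (modelAction p k hp).rho g v ∈ vecFil p (p ^ k) n := by
  simpa using Submodule.add_mem _
    (vecFil_antitone (Nat.le_succ n) (modelAction_rho_sub_mem (hp := hp) g hv)) hv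

theorem modelAction_rho_one : (modelAction p k hp).rho (Multiplicative.ofAdd 1) =
    Matrix.toLinAlgEquiv' (1 + shiftMat p (p ^ k)) :=
  congrArg Matrix.toLinAlgEquiv' (zmodPowHom_ofAdd_one _ _ _)

theorem modelAction_sigma_one : (modelAction p k hp).sigma (Multiplicative.ofAdd 1) =
    congruence p (p ^ k) (1 + shiftMat p (p ^ k)) :=
  congrArg (congruence p (p ^ k)) (zmodPowHom_ofAdd_one _ _ _)

theorem modelAction_rho_one_unitVec (a : ℕ) :
    (modelAction p k hp).rho (Multiplicative.ofAdd 1) (unitVec p (p ^ k) a) =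
      unitVec p (p ^ k) a + unitVec p (p ^ k) (a + 1) := by
  rw [modelAction_rho_one, Matrix.toLinAlgEquiv'_apply, Matrix.add_mulVec, Matrix.one_mulVec,
    shiftMat_mulVec]

theorem Model.rcomm_x (v : Fin (p ^ k) → ZMod p) (w : AltMat p (p ^ k)) :
    rcomm (⟨v, w, 1⟩ : Model p k hp) (Model.x p k hp) =
      ⟨(modelAction p k hp).rho (Multiplicative.ofAdd 1) v - v, theta p (p ^ k) w -
        (modelAction p k hp).half • wedge p (p ^ k) v
          ((modelAction p k hp).rho (Multiplicative.ofAdd 1) v), 1⟩ := by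
  rw [Model.x, FormExt.rcomm_top, ← ofAdd_neg, neg_neg, theta_apply, modelAction_sigma_one]
  rfl

theorem Model.iterComm_snd (w : AltMat p (p ^ k)) (n : ℕ) :
    iterComm (⟨0, w, 1⟩ : Model p k hp) (Model.x p k hp) n =
      ⟨0, (theta p (p ^ k) ^ n) w, 1⟩ := by
  induction n with
  | zero => rfl
  | succ n ih =>
    rw [iterComm, ih, Model.rcomm_x, pow_succ', Module.End.mul_apply]
    simp

/-- The second component is not needed exactly, only its degree: each step adds a multiple of e_n ∧
e_{n+1}, of degree 2n+1 ≥ n+1. -/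
theorem Model.exists_iterComm_y (n : ℕ) : ∃ w ∈ altFil p (p ^ k) n,
    iterComm (Model.y p k hp) (Model.x p k hp) n = ⟨unitVec p (p ^ k) n, w, 1⟩ := by
  induction n with
  | zero => exact ⟨0, Submodule.zero_mem _, rfl⟩
  | succ n ih =>
    obtain ⟨w, hw, h⟩ := ih
    rw [iterComm, h, Model.rcomm_x, modelAction_rho_one_unitVec, add_sub_cancel_left]
    refine ⟨_, ?_, rfl⟩
    refine Submodule.sub_mem _ (theta_mem_altFil hw) (Submodule.smul_mem _ _ ?_)
    rw [map_add, wedge_self, zero_add]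
    exact unitWedge_mem_altFil (by omega)

/-- Commutation with y sees only first components, so the unknown second component of the iterated
commutator disappears. The element is c_{m+1,j+1}. -/
theorem Model.iterComm_rcomm (m j : ℕ) :
    iterComm (rcomm (iterComm (Model.y p k hp) (Model.x p k hp) m) (Model.y p k hp))
      (Model.x p k hp) j = ⟨0, (theta p (p ^ k) ^ j) (unitWedge p (p ^ k) m 0), 1⟩ := by
  obtain ⟨w, -, h⟩ := Model.exists_iterComm_y (hp := hp) (k := k) m
  rw [h, Model.y, FormExt.rcomm_of_top_eq_one, Model.iterComm_snd]
  rfl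

/-- The terms of the lower central series of the model, for `i ≥ 2`. -/
def Model.series (p k : ℕ) [Fact p.Prime] (hp : Odd p) (i : ℕ) : Subgroup (Model p k hp) where
  -- The shifts come from c_i having leading vector e_{i-1}, and from c_{m,j} with m + j = i having
  -- degree (m-1) + (j-1) = i-2.
  carrier := {g | g.top = 1 ∧ g.fst ∈ vecFil p (p ^ k) (i - 1) ∧ g.snd ∈ altFil p (p ^ k) (i - 2)}
  mul_mem' := by
    rintro a b ⟨ha1, ha2, ha3⟩ ⟨hb1, hb2, hb3⟩
    refine ⟨by simp [ha1, hb1], ?_, ?_⟩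
    · simpa [ha1] using Submodule.add_mem _ ha2 hb2
    · simp only [FormExt.mul_snd, ha1, map_one, Module.End.one_apply]
      exact Submodule.add_mem _ (Submodule.add_mem _ ha3 hb3) (Submodule.smul_mem _ _
        (altFil_antitone (by omega) (wedge_mem_altFil ha2 hb2)))
  one_mem' := ⟨rfl, Submodule.zero_mem _, Submodule.zero_mem _⟩
  inv_mem' := by
    rintro a ⟨ha1, ha2, ha3⟩
    refine ⟨by simp [ha1], ?_, ?_⟩
    · simpa [ha1] using ha2
    · simpa [ha1] using ha3

theorem Model.mem_series {i : ℕ} {g : Model p k hp} : g ∈ Model.series p k hp i ↔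
    g.top = 1 ∧ g.fst ∈ vecFil p (p ^ k) (i - 1) ∧ g.snd ∈ altFil p (p ^ k) (i - 2) := Iff.rfl

open scoped commutatorElement in
-- The action moves both filtrations up by one, and wedging a vector of index ≥ i-1 with anything
-- already has degree ≥ i-1, one more than the i-th term requires.
theorem Model.commutator_series_le (i : ℕ) :
    ⁅Model.series p k hp i, ⊤⁆ ≤ Model.series p k hp (i + 1) := by
  rw [Subgroup.commutator_le]
  rintro ⟨v, w, t⟩ ⟨ht, hv, hw⟩ h -
  obtain rfl : t = 1 := ht
  simp only at hv hw
  rw [FormExt.commutatorElement_of_top_eq_one]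
  have hv' : v - (modelAction p k hp).rho h.top v ∈ vecFil p (p ^ k) (i + 1 - 1) := by
    rw [← neg_sub]
    exact Submodule.neg_mem _ (vecFil_antitone (by omega) (modelAction_rho_sub_mem h.top hv))
  have hw' : w - (modelAction p k hp).sigma h.top w ∈ altFil p (p ^ k) (i + 1 - 2) := by
    rw [← neg_sub]
    exact Submodule.neg_mem _ (altFil_antitone (by omega) (modelAction_sigma_sub_mem h.top hw))
  have hform : ∀ u u', u ∈ vecFil p (p ^ k) (i - 1) →
      (modelAction p k hp).form u u' ∈ altFil p (p ^ k) (i + 1 - 2) := fun u u' hu =>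
    altFil_antitone (by omega) (wedge_mem_altFil (n := 0) hu (by simp [vecFil_zero]))
  refine ⟨rfl, hv', ?_⟩
  refine Submodule.sub_mem _ (Submodule.sub_mem _ (Submodule.add_mem _ hw' ?_) ?_) ?_
  · exact Submodule.smul_mem _ _ (hform _ _ hv)
  · rw [FormExt.form_swap]
    exact Submodule.smul_mem _ _ (Submodule.neg_mem _ (hform _ _ (modelAction_rho_mem _ hv)))
  · exact Submodule.smul_mem _ _ (hform _ _ (vecFil_antitone (by omega) hv'))

theorem Model.series_eq_bot : Model.series p k hp (2 * p ^ k) = ⊥ := by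
  rw [eq_bot_iff]
  rintro ⟨v, w, t⟩ ⟨ht, hv, hw⟩
  have hq : 0 < p ^ k := pow_pos (Fact.out : p.Prime).pos k
  rw [vecFil_eq_bot (by omega), Submodule.mem_bot] at hv
  rw [altFil_eq_bot hp le_rfl, Submodule.mem_bot] at hw
  exact FormExt.ext hv hw ht

theorem Model.series_ne_bot (hk : 1 ≤ k) : Model.series p k hp (2 * p ^ k - 1) ≠ ⊥ := by
  intro h
  have hq : 2 ≤ p ^ k := (Fact.out : p.Prime).two_le.trans (Nat.le_self_pow (by omega) p)
  -- The wedge of the last two basis vectors has the greatest degree, 2q-3.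
  have hmem : (⟨0, unitWedge p (p ^ k) (p ^ k - 1) (p ^ k - 2), 1⟩ : Model p k hp) ∈
      Model.series p k hp (2 * p ^ k - 1) :=
    ⟨rfl, Submodule.zero_mem _, unitWedge_mem_altFil (by omega)⟩
  rw [h, Subgroup.mem_bot] at hmem
  have h1 := congrArg FormExt.snd hmem
  have h2 : (unitWedge p (p ^ k) (p ^ k - 1) (p ^ k - 2)).1 ⟨p ^ k - 1, by omega⟩
      ⟨p ^ k - 2, by omega⟩ = 0 := congrArg (fun w : AltMat p (p ^ k) => w.1 _ _) h1
  rw [unitWedge_apply, if_pos ⟨rfl, rfl⟩, if_neg (by simp only; omega), sub_zero] at h2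
  exact one_ne_zero h2

/-- A subgroup which contains the next term of the series, and the iterated commutators of the
right weight, contains a given term of the series. -/
theorem Model.series_le (i : ℕ) (hi : 2 ≤ i) (K : Subgroup (Model p k hp))
    (hK : Model.series p k hp (i + 1) ≤ K)
    (hc : i ≤ p ^ k → iterComm (Model.y p k hp) (Model.x p k hp) (i - 1) ∈ K)
    (hcc : ∀ m j, Even m → 2 ≤ m → m < p ^ k → 1 ≤ j → j ≤ p ^ k → m + j = i →
      iterComm (rcomm (iterComm (Model.y p k hp) (Model.x p k hp) (m - 1)) (Model.y p k hp))
        (Model.x p k hp) (j - 1) ∈ K) :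
    Model.series p k hp i ≤ K := by
  have hodd : Odd (p ^ k) := hp.pow
  have hsnd : ∀ w ∈ altFil p (p ^ k) (i - 2), (⟨0, w, 1⟩ : Model p k hp) ∈ K := by
    have hle : altFil p (p ^ k) (i - 2) ≤ AddSubgroup.toZModSubmodule p
        (Subgroup.toAddSubgroup' (K.comap (FormExt.sndHom (modelAction p k hp)))) := by
      refine (altFil_le_span_sup (i - 2)).trans (sup_le (Submodule.span_le.mpr ?_) ?_)
      · rintro _ ⟨r, j, hr, hrj, rfl⟩
        change (⟨0, _, 1⟩ : Model p k hp) ∈ K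
        rcases lt_or_ge r (p ^ k) with h1 | h1
        · rcases lt_or_ge j (p ^ k) with h2 | h2
          · have h3 : r + 1 ≠ p ^ k := fun h => by
              rw [← h, Nat.odd_add_one] at hodd
              exact hodd hr
            have := hcc (r + 1) (j + 1) hr.add_one (by have := hr.pos; omega) (by omega) (by omega)
              (by omega) (by omega)
            rwa [Nat.add_sub_cancel, Nat.add_sub_cancel, Model.iterComm_rcomm] at this
          · rw [← Nat.sub_add_cancel h2, pow_add, theta_pow_size, mul_zero]
            exact K.one_mem
        · rw [unitWedge_eq_zero_left _ h1, map_zero]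
          exact K.one_mem
      · intro w hw
        change (⟨0, w, 1⟩ : Model p k hp) ∈ K
        exact hK ⟨rfl, Submodule.zero_mem _, altFil_antitone (by omega) hw⟩
    intro w hw
    exact hle hw
  rintro ⟨v, w, t⟩ ⟨ht, hv, hw⟩
  obtain rfl : t = 1 := ht
  simp only at hv hw
  rcases lt_or_ge (p ^ k) i with hlt | hle
  · rw [vecFil_eq_bot (by omega), Submodule.mem_bot] at hv
    subst hv
    exact hsnd w hw
  · obtain ⟨w0, hw0, h0⟩ := Model.exists_iterComm_y (hp := hp) (k := k) (i - 1)
    have hc' := hc hle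
    rw [h0] at hc'
    -- The a-th power of c_i carries the leading coordinate; the rest of the vector lies in the next
    -- term of the series, and the last factor `hwK` corrects the alternating part, including the
    -- cocycle.
    set a : ZMod p := v ⟨i - 1, by omega⟩ with ha
    set u := unitVec p (p ^ k) (i - 1) with hu
    have hcu : (⟨a • u, a • w0, 1⟩ : Model p k hp) ∈ K := by
      have h := K.pow_mem hc' a.val
      rw [FormExt.pow_of_top_eq_one, ← Nat.cast_smul_eq_nsmul (ZMod p),
        ← Nat.cast_smul_eq_nsmul (ZMod p), ZMod.natCast_zmod_val] at h
      exact h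
    have hv' : v - a • u ∈ vecFil p (p ^ k) i := by
      rw [mem_vecFil_iff] at hv ⊢
      intro j hj
      simp only [Pi.sub_apply, Pi.smul_apply, hu, unitVec, smul_eq_mul]
      split_ifs with hj'
      · rw [mul_one, ha, sub_eq_zero]
        congr 1
        exact Fin.ext hj'
      · rw [hv j (by omega), mul_zero, sub_zero]
    have hvK : (⟨v - a • u, 0, 1⟩ : Model p k hp) ∈ K :=
      hK ⟨rfl, hv', Submodule.zero_mem _⟩
    have hform : (modelAction p k hp).form (a • u) (v - a • u) ∈ altFil p (p ^ k) (i - 2) :=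
      altFil_antitone (by omega) (wedge_mem_altFil (m := i - 1) (n := i)
        (Submodule.smul_mem _ _ (unitVec_mem_vecFil le_rfl)) hv')
    have hwK := hsnd (w - a • w0 -
        (modelAction p k hp).half • (modelAction p k hp).form (a • u) (v - a • u)) (by
      refine Submodule.sub_mem _ (Submodule.sub_mem _ hw (Submodule.smul_mem _ _
        (altFil_antitone (by omega) hw0))) (Submodule.smul_mem _ _ hform))
    convert K.mul_mem (K.mul_mem hcu hvK) hwK using 1
    ext1
    · simp
    · simp only [FormExt.mul_snd, FormExt.mul_fst, map_one, Module.End.one_apply, map_zero,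
        smul_zero, add_zero, FormExt.mul_top, mul_one]
      abel
    · simp

end

/-! ### The lower central series of the model -/

open scoped commutatorElement in
theorem rcomm_mem_lowerCentralSeries {G : Type*} [Group G] {a : G} (b : G) {n : ℕ}
    (ha : a ∈ (⊤ : Subgroup G).lowerCentralSeries n) :
    rcomm a b ∈ (⊤ : Subgroup G).lowerCentralSeries (n + 1) := by
  have h : rcomm a b = ⁅a⁻¹, b⁻¹⁆ := by
    rw [rcomm, commutatorElement_def, inv_inv, inv_inv]
  rw [h, Subgroup.lowerCentralSeries_succ]
  exact Subgroup.commutator_mem_commutator (inv_mem ha) (Subgroup.mem_top _)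

theorem iterComm_mem_lowerCentralSeries {G : Type*} [Group G] {a : G} (b : G) {n : ℕ}
    (ha : a ∈ (⊤ : Subgroup G).lowerCentralSeries n) (j : ℕ) :
    iterComm a b j ∈ (⊤ : Subgroup G).lowerCentralSeries (n + j) := by
  induction j with
  | zero => exact ha
  | succ j ih => exact rcomm_mem_lowerCentralSeries b ih

theorem iterComm_mem_gammaTerm {G : Type*} [Group G] (x y : G) (i : ℕ) :
    iterComm y x (i - 1) ∈ gammaTerm G i := by
  have := iterComm_mem_lowerCentralSeries (n := 0) x (Subgroup.mem_top y) (i - 1)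
  rwa [zero_add] at this

theorem iterComm_rcomm_mem_gammaTerm {G : Type*} [Group G] (x y : G) {m j : ℕ} (hm : 1 ≤ m)
    (hj : 1 ≤ j) : iterComm (rcomm (iterComm y x (m - 1)) y) x (j - 1) ∈ gammaTerm G (m + j) := by
  have := iterComm_mem_lowerCentralSeries x
    (rcomm_mem_lowerCentralSeries y (iterComm_mem_gammaTerm x y m)) (j - 1)
  rwa [show m - 1 + 1 + (j - 1) = m + j - 1 by omega] at this

section

variable {p k : ℕ} [Fact p.Prime] {hp : Odd p}

/-- Descending induction from the trivial term of index 2q. It serves both for the lower bound on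
γ_i and for generation by x and y. -/
theorem Model.series_le_of_forall_le {K : Subgroup (Model p k hp)} {n : ℕ} (hn : 2 ≤ n)
    (hc : ∀ i, n ≤ i → iterComm (Model.y p k hp) (Model.x p k hp) (i - 1) ∈ K)
    (hcc : ∀ m j, 1 ≤ m → 1 ≤ j → n ≤ m + j →
      iterComm (rcomm (iterComm (Model.y p k hp) (Model.x p k hp) (m - 1)) (Model.y p k hp))
        (Model.x p k hp) (j - 1) ∈ K) :
    Model.series p k hp n ≤ K := by
  rcases le_or_gt (2 * p ^ k) n with h | h
  · refine le_trans ?_ ((Model.series_eq_bot (hp := hp) (k := k)).le.trans bot_le)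
    rintro g ⟨h1, h2, h3⟩
    exact ⟨h1, vecFil_antitone (by omega) h2, altFil_antitone (by omega) h3⟩
  · induction hd : 2 * p ^ k - n generalizing n with
    | zero => omega
    | succ d ih =>
      refine Model.series_le n hn K ?_ (fun _ => hc n le_rfl)
        (fun m j _ hm _ hj _ hmj => hcc m j (by omega) hj hmj.ge)
      rcases eq_or_lt_of_le (show n + 1 ≤ 2 * p ^ k from h) with h' | h'
      · rw [h', Model.series_eq_bot]
        exact bot_le
      · exact ih (n := n + 1) (by omega) (fun i hi => hc i (by omega))
          (fun m j hm hj hmj => hcc m j hm hj (by omega)) h' (by omega)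

/-- The projection of the model onto its largest abelian quotient. -/
def Model.abHom (p k : ℕ) [Fact p.Prime] (hp : Odd p) :
    Model p k hp →* Multiplicative (ZMod (p ^ k)) × Multiplicative (ZMod p) where
  toFun g := (g.top, Multiplicative.ofAdd (g.fst ⟨0, pow_pos (Fact.out : p.Prime).pos k⟩))
  map_one' := rfl
  map_mul' a b := by
    have h := modelAction_rho_sub_mem (hp := hp) a.top (n := 0) (v := b.fst) (by simp [vecFil_zero])
    rw [mem_vecFil_iff] at h
    have h0 := h ⟨0, pow_pos (Fact.out : p.Prime).pos k⟩ Nat.zero_lt_one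
    rw [Pi.sub_apply, sub_eq_zero] at h0
    refine Prod.ext rfl (congrArg Multiplicative.ofAdd ?_)
    change a.fst _ + _ = a.fst _ + _
    rw [h0]
    rfl

theorem Model.ker_abHom : (Model.abHom p k hp).ker = Model.series p k hp 2 := by
  ext g
  rw [MonoidHom.mem_ker, Model.mem_series, altFil_zero hp, mem_vecFil_iff]
  simp only [Model.abHom, MonoidHom.coe_mk, OneHom.coe_mk, Prod.mk_eq_one, ofAdd_eq_one,
    Submodule.mem_top, and_true]
  refine and_congr_right fun _ => ⟨fun h i hi => ?_, fun h => h _ Nat.zero_lt_one⟩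
  rwa [show i = ⟨0, pow_pos (Fact.out : p.Prime).pos k⟩ from Fin.ext (by simp only; omega)]

theorem Model.abHom_surjective : Function.Surjective (Model.abHom p k hp) := by
  rintro ⟨a, b⟩
  exact ⟨⟨fun _ => b.toAdd, 0, a⟩, rfl⟩

/-- From above, the start is an abelian quotient with kernel the second term; from below, γ_i
contains every iterated commutator of weight at least i. -/
theorem Model.gammaTerm_eq {i : ℕ} (hi : 2 ≤ i) :
    gammaTerm (Model p k hp) i = Model.series p k hp i := by
  refine le_antisymm ?_ ?_
  · induction i, hi using Nat.le_induction with
    | base =>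
      rw [← Model.ker_abHom]
      exact Abelianization.commutator_subset_ker _
    | succ i hi ih =>
      rw [gammaTerm, show i + 1 - 1 = (i - 1) + 1 by omega, Subgroup.lowerCentralSeries_succ]
      exact (Subgroup.commutator_mono ih le_rfl).trans (Model.commutator_series_le i)
  · refine Model.series_le_of_forall_le hi (fun n hn => ?_) (fun m j hm hj hmj => ?_)
    · exact Subgroup.lowerCentralSeries_antitone _ (Nat.sub_le_sub_right hn 1)
        (iterComm_mem_gammaTerm _ _ n)
    · exact Subgroup.lowerCentralSeries_antitone _ (Nat.sub_le_sub_right hmj 1)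
        (iterComm_rcomm_mem_gammaTerm _ _ hm hj)

end

/-! ### Ranks of the factors of the model -/

section

variable {p q : ℕ} [Fact p.Prime]

theorem mem_altFil_succ (hp : Odd p) {n : ℕ} {w : AltMat p q} (hw : w ∈ altFil p q n)
    (h : ∀ i j : Fin q, i < j → (i : ℕ) + j = n → w.1 i j = 0) : w ∈ altFil p q (n + 1) := by
  rw [mem_altFil_iff hp] at hw ⊢
  intro i j hij
  rcases (Nat.lt_succ_iff.mp hij).lt_or_eq with h1 | h1
  · exact hw i j h1
  · rcases lt_trichotomy i j with h2 | rfl | h2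
    · exact h i j h2 h1
    · exact AltMat.apply_self hp w i
    · rw [AltMat.apply_swap w, h j i h2 (by omega), neg_zero]

/-- The bound 2(lo + s) < n keeps the prescribed positions strictly above the diagonal, so distinct
unit wedges in the sum do not interfere. -/
theorem exists_mem_altFil_forall_eq (n lo N : ℕ) (h : ∀ s < N, 2 * (lo + s) < n)
    (c : ℕ → ZMod p) : ∃ w ∈ altFil p q n, ∀ s < N, ∀ i j : Fin q, (i : ℕ) = lo + s →
      (i : ℕ) + j = n → w.1 i j = c s := by
  refine ⟨∑ s ∈ Finset.range N, c s • unitWedge p q (lo + s) (n - (lo + s)),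
    Submodule.sum_mem _ fun s hs => Submodule.smul_mem _ _ (unitWedge_mem_altFil (by omega)),
    fun s hs i j hi hij => ?_⟩
  rw [Submodule.coe_sum, Matrix.sum_apply, Finset.sum_eq_single s]
  · simp only [Submodule.coe_smul, Matrix.smul_apply, unitWedge_apply]
    have := h s hs
    rw [if_pos (by omega), if_neg (by omega), sub_zero, smul_eq_mul, mul_one]
  · intro t ht hts
    have := h s hs
    have := h t (Finset.mem_range.mp ht)
    simp only [Submodule.coe_smul, Matrix.smul_apply, unitWedge_apply]
    rw [if_neg (by omega), if_neg (by omega), sub_zero, smul_zero]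
  · intro hs'
    exact absurd (Finset.mem_range.mpr hs) hs'

end

section

variable {p k : ℕ} [Fact p.Prime] {hp : Odd p}

/-- The cocycle ½ v ∧ v' has degree at least 2(i-1) ≥ i-1 on the i-th term, so f kills it and an
additive map becomes a group homomorphism. -/
theorem Model.exists_hom_of_addMonoidHom {i r : ℕ} (hi : 2 ≤ i)
    (f : (Fin (p ^ k) → ZMod p) × AltMat p (p ^ k) →+ (Fin r → ZMod p))
    (hf : ∀ v ∈ vecFil p (p ^ k) (i - 1), ∀ w ∈ altFil p (p ^ k) (i - 2),
      (f (v, w) = 0 ↔ v ∈ vecFil p (p ^ k) i ∧ w ∈ altFil p (p ^ k) (i - 1)))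
    (hsurj : ∀ c, ∃ v ∈ vecFil p (p ^ k) (i - 1), ∃ w ∈ altFil p (p ^ k) (i - 2), f (v, w) = c) :
    ∃ F : Model.series p k hp i →* (Fin r → Multiplicative (ZMod p)),
      Function.Surjective F ∧ ∀ g, F g = 1 ↔ g.1 ∈ Model.series p k hp (i + 1) := by
  refine ⟨MonoidHom.mk' (fun g t => Multiplicative.ofAdd (f (g.1.fst, g.1.snd) t)) ?_, ?_, ?_⟩
  · rintro ⟨⟨v, w, t⟩, ht, hv, hw⟩ ⟨⟨v', w', t'⟩, ht', hv', hw'⟩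
    obtain rfl : t = 1 := ht
    simp only at hv hw hv' hw'
    have h : f (v + v', w + w' + (modelAction p k hp).half • (modelAction p k hp).form v v') =
        f (v, w) + f (v', w') := by
      have h1 : f (0, (modelAction p k hp).half • (modelAction p k hp).form v v') = 0 :=
        (hf _ (Submodule.zero_mem _) _ (Submodule.smul_mem _ _
          (altFil_antitone (by omega) (wedge_mem_altFil hv hv')))).mpr
          ⟨Submodule.zero_mem _, Submodule.smul_mem _ _
            (altFil_antitone (by omega) (wedge_mem_altFil hv hv'))⟩
      calc f (v + v', w + w' + (modelAction p k hp).half • (modelAction p k hp).form v v')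
          = f ((v, w) + (v', w')
              + (0, (modelAction p k hp).half • (modelAction p k hp).form v v')) := by
            rw [Prod.mk_add_mk, Prod.mk_add_mk, add_zero]
        _ = f (v, w) + f (v', w') := by rw [map_add, map_add, h1, add_zero]
    funext s
    simp only [Subgroup.coe_mul, FormExt.mul_fst, FormExt.mul_snd, map_one, Module.End.one_apply]
    rw [h]
    rfl
  · intro c
    obtain ⟨v, hv, w, hw, h⟩ := hsurj fun t => (c t).toAdd
    refine ⟨⟨⟨v, w, 1⟩, rfl, hv, hw⟩, ?_⟩
    funext t
    exact congrArg Multiplicative.ofAdd (congrFun h t)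
  · rintro ⟨⟨v, w, t⟩, ht, hv, hw⟩
    have key : (⟨v, w, t⟩ : Model p k hp) ∈ Model.series p k hp (i + 1) ↔ f (v, w) = 0 :=
      (and_iff_right ht).trans (hf v hv w hw).symm
    refine Iff.trans ?_ key.symm
    exact ⟨fun h => funext fun t => ofAdd_eq_one.mp (congrFun h t),
      fun h => funext fun t => ofAdd_eq_one.mpr (congrFun h t)⟩

/-- The coordinates are the entries (t, i-2-t) above the diagonal, (i+1)/2 - 1 in number for either
parity, and in the last slot the vector coordinate i-1. -/
theorem Model.exists_hom_low {i : ℕ} (hi : 2 ≤ i) (hik : i ≤ p ^ k) :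
    ∃ F : Model.series p k hp i →* (Fin ((i + 1) / 2) → Multiplicative (ZMod p)),
      Function.Surjective F ∧ ∀ g, F g = 1 ↔ g.1 ∈ Model.series p k hp (i + 1) := by
  refine Model.exists_hom_of_addMonoidHom hi (AddMonoidHom.mk' (fun u t =>
    if (t : ℕ) + 1 < (i + 1) / 2 then u.2.1 ⟨t, by omega⟩ ⟨i - 2 - t, by omega⟩
    else u.1 ⟨i - 1, by omega⟩) ?_) ?_ ?_
  · intro u u'
    funext t
    simp only [Pi.add_apply]
    split_ifs <;> rfl
  · intro v hv w hw
    simp only [AddMonoidHom.mk'_apply]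
    constructor
    · intro h
      have h' := fun t => congrFun h t
      simp only [Pi.zero_apply] at h'
      constructor
      · have h1 := h' ⟨(i + 1) / 2 - 1, by omega⟩
        rw [if_neg (by simp only; omega)] at h1
        rw [mem_vecFil_iff] at hv ⊢
        intro j hj
        rcases Nat.lt_or_ge j (i - 1) with h2 | h2
        · exact hv j h2
        · rwa [show j = ⟨i - 1, by omega⟩ from Fin.ext (by simp only; omega)]
      · rw [show i - 1 = i - 2 + 1 by omega]
        refine mem_altFil_succ hp hw fun a b hab hsum => ?_
        have hab' : (a : ℕ) < b := hab
        have h1 := h' ⟨a, by omega⟩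
        rw [if_pos (by simp only; omega)] at h1
        convert h1 using 2
        exact Fin.ext (by simp only; omega)
    · rintro ⟨hv, hw⟩
      rw [mem_vecFil_iff] at hv
      rw [mem_altFil_iff hp] at hw
      funext t
      simp only [Pi.zero_apply]
      split_ifs
      · exact hw _ _ (by simp only; omega)
      · exact hv _ (by simp only; omega)
  · intro c
    obtain ⟨w, hw, h⟩ := exists_mem_altFil_forall_eq (p := p) (q := p ^ k) (i - 2) 0
      ((i + 1) / 2 - 1) (by omega) (fun t => if h : t < (i + 1) / 2 then c ⟨t, h⟩ else 0)
    refine ⟨c ⟨(i + 1) / 2 - 1, by omega⟩ • unitVec p (p ^ k) (i - 1),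
      Submodule.smul_mem _ _ (unitVec_mem_vecFil le_rfl), w, hw, ?_⟩
    funext t
    simp only [AddMonoidHom.mk'_apply]
    split_ifs with ht
    · rw [h t (by omega) _ _ (by simp) (by simp only; omega), dif_pos t.2]
    · simp only [Pi.smul_apply, unitVec, if_true, smul_eq_mul, mul_one]
      congr 1
      exact Fin.ext (by simp only; omega)

/-- The vector part is now zero, and a column index of at most q-1 forces the row index to start at
i-1-q. -/
theorem Model.exists_hom_high {i : ℕ} (hik : p ^ k + 1 ≤ i) (hk : 1 ≤ k) :
    ∃ F : Model.series p k hp i →* (Fin ((2 * p ^ k - i + 1) / 2) → Multiplicative (ZMod p)),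
      Function.Surjective F ∧ ∀ g, F g = 1 ↔ g.1 ∈ Model.series p k hp (i + 1) := by
  have hq : 2 ≤ p ^ k := (Fact.out : p.Prime).two_le.trans (Nat.le_self_pow (by omega) p)
  refine Model.exists_hom_of_addMonoidHom (by omega) (AddMonoidHom.mk' (fun u t =>
    u.2.1 ⟨i - 1 - p ^ k + t, by omega⟩ ⟨p ^ k - 1 - t, by omega⟩) ?_) ?_ ?_
  · intro u u'
    rfl
  · intro v hv w hw
    constructor
    · intro h
      have h' : ∀ t : Fin ((2 * p ^ k - i + 1) / 2),
          w.1 ⟨i - 1 - p ^ k + t, by omega⟩ ⟨p ^ k - 1 - t, by omega⟩ = 0 := congrFun h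
      constructor
      · rw [vecFil_eq_bot (by omega), Submodule.mem_bot] at hv
        rw [hv]
        exact Submodule.zero_mem _
      · rw [show i - 1 = i - 2 + 1 by omega]
        refine mem_altFil_succ hp hw fun a b hab hsum => ?_
        have hab' : (a : ℕ) < b := hab
        have h1 := h' ⟨a - (i - 1 - p ^ k), by omega⟩
        convert h1 using 2
        · exact Fin.ext (by simp only; omega)
        · exact Fin.ext (by simp only; omega)
    · rintro ⟨hv, hw⟩
      rw [mem_altFil_iff hp] at hw
      funext t
      exact hw _ _ (by simp only; omega)
  · intro c
    obtain ⟨w, hw, h⟩ := exists_mem_altFil_forall_eq (p := p) (q := p ^ k) (i - 2) (i - 1 - p ^ k)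
      ((2 * p ^ k - i + 1) / 2) (by omega)
      (fun t => if h : t < (2 * p ^ k - i + 1) / 2 then c ⟨t, h⟩ else 0)
    refine ⟨0, Submodule.zero_mem _, w, hw, ?_⟩
    funext t
    exact (h t t.2 ⟨i - 1 - p ^ k + t, by omega⟩ ⟨p ^ k - 1 - t, by omega⟩ rfl
      (by simp only; omega)).trans (dif_pos t.2)

theorem Model.closure_x_y : Subgroup.closure {Model.x p k hp, Model.y p k hp} = ⊤ := by
  set K := Subgroup.closure {Model.x p k hp, Model.y p k hp} with hK
  have hx : Model.x p k hp ∈ K := Subgroup.subset_closure (by simp)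
  have hy : Model.y p k hp ∈ K := Subgroup.subset_closure (by simp)
  have hr : ∀ a ∈ K, ∀ b ∈ K, rcomm a b ∈ K := fun a ha b hb =>
    K.mul_mem (K.mul_mem (K.mul_mem (K.inv_mem ha) (K.inv_mem hb)) ha) hb
  have hiter : ∀ a ∈ K, ∀ n, iterComm a (Model.x p k hp) n ∈ K := by
    intro a ha n
    induction n with
    | zero => exact ha
    | succ n ih => exact hr _ ih _ hx
  have h2 : Model.series p k hp 2 ≤ K := Model.series_le_of_forall_le le_rfl
    (fun i _ => hiter _ hy _) (fun m j _ _ _ => hiter _ (hr _ (hiter _ hy _) _ hy) _)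
  rw [eq_top_iff]
  rintro g -
  -- Modulo the second term, which K contains, every element is x^m y^n; the negation in m undoes
  -- the sign in `Model.x`.
  obtain ⟨m, hm⟩ : ∃ m : ℕ, (Model.abHom p k hp g).1 = Multiplicative.ofAdd (-1) ^ m := by
    refine ⟨(-(Model.abHom p k hp g).1.toAdd).val, ?_⟩
    rw [← ofAdd_nsmul, nsmul_eq_mul, ZMod.natCast_zmod_val]
    simp
  obtain ⟨n, hn⟩ : ∃ n : ℕ, (Model.abHom p k hp g).2 = Multiplicative.ofAdd 1 ^ n := by
    refine ⟨((Model.abHom p k hp g).2.toAdd).val, ?_⟩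
    rw [← ofAdd_nsmul, nsmul_eq_mul, ZMod.natCast_zmod_val]
    simp
  have hg : g * (Model.x p k hp ^ m * Model.y p k hp ^ n)⁻¹ ∈ K := by
    refine h2 ?_
    rw [← Model.ker_abHom, MonoidHom.mem_ker, map_mul, map_inv, map_mul, map_pow, map_pow,
      mul_inv_eq_one]
    have e1 : Model.abHom p k hp (Model.x p k hp) = (Multiplicative.ofAdd (-1), 1) := rfl
    have e2 : Model.abHom p k hp (Model.y p k hp) = (1, Multiplicative.ofAdd 1) := by
      simp [Model.abHom, Model.y, unitVec]
    rw [e1, e2]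
    refine Prod.ext ?_ ?_
    · simp [hm]
    · simp [hn]
  exact (Subgroup.mul_mem_cancel_right _
    (K.inv_mem (K.mul_mem (K.pow_mem hx m) (K.pow_mem hy n)))).mp hg

end

/-! ### Bounding the order from the relations -/

open scoped commutatorElement in
theorem Commute.of_commutatorElement_eq_one {G : Type*} [Group G] {a b : G} (h : ⁅a, b⁆ = 1) :
    Commute a b := commutatorElement_eq_one_iff_commute.mp h

/-- A subgroup generated by a set `s` is normal as soon as conjugation by generators of the group
preserves it. -/
theorem Subgroup.normal_closure_of_conj_mem {G : Type*} [Group G] {s t : Set G}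
    (ht : Subgroup.closure t = ⊤)
    (h : ∀ g ∈ t, ∀ a ∈ s, g * a * g⁻¹ ∈ Subgroup.closure s ∧ g⁻¹ * a * g ∈ Subgroup.closure s) :
    (Subgroup.closure s).Normal := by
  have key : ∀ g : G, (∀ a ∈ s, g * a * g⁻¹ ∈ Subgroup.closure s) →
      ∀ a ∈ Subgroup.closure s, g * a * g⁻¹ ∈ Subgroup.closure s := by
    intro g hg a ha
    have hle : Subgroup.closure s ≤
        (Subgroup.closure s).comap (MulAut.conj g).toMonoidHom := (Subgroup.closure_le _).mpr hg
    exact hle ha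
  have hle : (⊤ : Subgroup G) ≤ Subgroup.normalizer (Subgroup.closure s : Set G) := by
    rw [← ht, Subgroup.closure_le]
    intro g hg
    rw [SetLike.mem_coe, Subgroup.mem_normalizer_iff]
    intro a
    refine ⟨fun ha => key g (fun b hb => (h g hg b hb).1) a ha, fun ha => ?_⟩
    have h1 := key g⁻¹ (fun b hb => by rw [inv_inv]; exact (h g hg b hb).2) _ ha
    simpa [mul_assoc] using h1
  exact Subgroup.normalizer_eq_top_iff.mp (top_le_iff.mp hle)

/-- A finite family of commuting elements of exponent `p` generates an image of a power of the
cyclic group of order `p`. -/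
theorem exists_hom_closure_range_le {G ι : Type*} [Group G] [Fintype ι] (p : ℕ) [NeZero p]
    (g : ι → G) (hpow : ∀ i, g i ^ p = 1) (hcomm : ∀ i j, Commute (g i) (g j)) :
    ∃ f : (ι → Multiplicative (ZMod p)) →* G, Subgroup.closure (Set.range g) ≤ f.range := by
  classical
  have hc : Pairwise fun i j => ∀ a b : Multiplicative (ZMod p),
      Commute (zmodPowHom p (g i) (hpow i) a) (zmodPowHom p (g j) (hpow j) b) :=
    fun i j _ _ _ => (hcomm i j).pow_pow _ _
  refine ⟨MonoidHom.noncommPiCoprod (fun i => zmodPowHom p (g i) (hpow i)) hc, ?_⟩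
  rw [Subgroup.closure_le]
  rintro _ ⟨i, rfl⟩
  exact ⟨Pi.mulSingle i (Multiplicative.ofAdd 1),
    (MonoidHom.noncommPiCoprod_mulSingle _ _ _).trans (zmodPowHom_ofAdd_one _ _ _)⟩

section

open scoped commutatorElement

variable {G : Type*} [Group G] {p q : ℕ}

/-- The conjugate of `y` by the `i`-th power of `x`. -/
def conjPow (x y : G) (i : ℤ) : G := x ^ (-i) * y * x ^ i

theorem conj_conjPow (x y : G) (i : ℤ) : x * conjPow x y i * x⁻¹ = conjPow x y (i - 1) := by
  simp only [conjPow]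
  group

theorem inv_conj_conjPow (x y : G) (i : ℤ) : x⁻¹ * conjPow x y i * x = conjPow x y (i + 1) := by
  simp only [conjPow]
  group

theorem exists_fin_conjPow_eq [NeZero q] {x : G} (y : G) (hx : x ^ q = 1) (i : ℤ) :
    ∃ j : Fin q, conjPow x y i = conjPow x y (j : ℕ) := by
  have hq : (0 : ℤ) < q := by exact_mod_cast NeZero.pos q
  have h1 := Int.emod_nonneg i hq.ne'
  have h2 := Int.emod_lt_of_pos i hq
  refine ⟨⟨(i % q).toNat, by omega⟩, ?_⟩
  have h3 : x ^ i = x ^ (i % q) := by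
    conv_lhs => rw [← Int.emod_add_mul_ediv i q, zpow_add, zpow_mul, zpow_natCast, hx, one_zpow,
      mul_one]
  simp only [conjPow, Int.toNat_of_nonneg h1, zpow_neg, h3]

theorem conj_commutatorElement (g a b : G) : g * ⁅a, b⁆ * g⁻¹ = ⁅g * a * g⁻¹, g * b * g⁻¹⁆ := by
  simp only [commutatorElement_def]
  group

/-- Every element is a power of x, times a product of conjugates y^(x^i), times a product of their
commutators. The conjugates commute modulo the subgroup C of commutators, and C is abelian and
centralised by H. Only a surjection of sets is needed, for counting. -/
theorem exists_surjective_of_generators [NeZero p] [NeZero q] {x y : G}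
    (hgen : Subgroup.closure {x, y} = ⊤) (H : Subgroup G) [hH : H.Normal] (hy : y ∈ H)
    (hx : x ^ q = 1) (hpow : ∀ h ∈ H, h ^ p = 1)
    (hcomm : ∀ a ∈ H, ∀ b ∈ H, ∀ c ∈ H, ⁅⁅a, b⁆, c⁆ = 1) :
    ∃ f : Multiplicative (ZMod q) × (Fin q → Multiplicative (ZMod p)) ×
      ({ij : Fin q × Fin q // ij.1 < ij.2} → Multiplicative (ZMod p)) → G,
      Function.Surjective f := by
  have hyH : ∀ i, conjPow x y i ∈ H := fun i => by
    have := hH.conj_mem y hy (x ^ (-i))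
    rwa [zpow_neg, inv_inv, ← zpow_neg] at this
  have hcH : ∀ i j, ⁅conjPow x y i, conjPow x y j⁆ ∈ H := fun i j => by
    rw [commutatorElement_def]
    exact H.mul_mem (H.mul_mem (H.mul_mem (hyH i) (hyH j)) (H.inv_mem (hyH i))) (H.inv_mem (hyH j))
  have hcc : ∀ i j, ∀ h ∈ H, Commute ⁅conjPow x y i, conjPow x y j⁆ h := fun i j h hh =>
    Commute.of_commutatorElement_eq_one (hcomm _ (hyH i) _ (hyH j) _ hh)
  set C : Subgroup G :=
    Subgroup.closure {g | ∃ i j, g = ⁅conjPow x y i, conjPow x y j⁆} with hC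
  -- Conjugation by x shifts the indices, and y centralises C.
  have hCn : C.Normal := by
    refine Subgroup.normal_closure_of_conj_mem hgen ?_
    rintro g (rfl | rfl) _ ⟨i, j, rfl⟩
    · refine ⟨Subgroup.subset_closure ⟨i - 1, j - 1, ?_⟩,
        Subgroup.subset_closure ⟨i + 1, j + 1, ?_⟩⟩
      · rw [conj_commutatorElement, conj_conjPow, conj_conjPow]
      · have h := conj_commutatorElement g⁻¹ (conjPow g y i) (conjPow g y j)
        rw [inv_inv, inv_conj_conjPow, inv_conj_conjPow] at h
        exact h
    · have h := hcc i j g hy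
      rw [← h.eq, mul_inv_cancel_right, h.inv_right.symm.eq, inv_mul_cancel_right]
      exact ⟨Subgroup.subset_closure ⟨i, j, rfl⟩, Subgroup.subset_closure ⟨i, j, rfl⟩⟩
  set K : Subgroup G := Subgroup.closure (Set.range (conjPow x y)) with hK
  have hyK : y ∈ K := Subgroup.subset_closure ⟨0, by simp [conjPow]⟩
  have hKn : K.Normal := by
    refine Subgroup.normal_closure_of_conj_mem hgen ?_
    rintro g (rfl | rfl) _ ⟨i, rfl⟩
    · refine ⟨Subgroup.subset_closure ⟨i - 1, ?_⟩, Subgroup.subset_closure ⟨i + 1, ?_⟩⟩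
      · rw [conj_conjPow]
      · rw [inv_conj_conjPow]
    · have h : conjPow x g i ∈ K := Subgroup.subset_closure ⟨i, rfl⟩
      exact ⟨K.mul_mem (K.mul_mem hyK h) (K.inv_mem hyK),
        K.mul_mem (K.mul_mem (K.inv_mem hyK) h) hyK⟩
  obtain ⟨f₂, hf₂⟩ := exists_hom_closure_range_le p
    (fun ij : {ij : Fin q × Fin q // ij.1 < ij.2} =>
      ⁅conjPow x y (ij.1.1 : ℕ), conjPow x y (ij.1.2 : ℕ)⁆)
    (fun ij => hpow _ (hcH _ _)) (fun _ _ => hcc _ _ _ (hcH _ _))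
  have hCf : C ≤ f₂.range := by
    refine le_trans ((Subgroup.closure_le _).mpr ?_) hf₂
    rintro _ ⟨i, j, rfl⟩
    -- As x^q = 1, indices matter modulo q; swapping inverts the commutator, so pairs a < b suffice.
    obtain ⟨a, ha⟩ := exists_fin_conjPow_eq y hx i
    obtain ⟨b, hb⟩ := exists_fin_conjPow_eq y hx j
    rw [ha, hb]
    rcases lt_trichotomy a b with h | rfl | h
    · exact Subgroup.subset_closure ⟨⟨(a, b), h⟩, rfl⟩
    · rw [commutatorElement_self]
      exact Subgroup.one_mem _
    · rw [← commutatorElement_inv]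
      exact Subgroup.inv_mem _ (Subgroup.subset_closure ⟨⟨(b, a), h⟩, rfl⟩)
  obtain ⟨f₁, hf₁⟩ := exists_hom_closure_range_le p
    (fun i : Fin q => (QuotientGroup.mk (conjPow x y (i : ℕ)) : G ⧸ C))
    (fun i => by rw [← QuotientGroup.mk_pow, hpow _ (hyH _), QuotientGroup.mk_one])
    (fun i j => Commute.of_commutatorElement_eq_one <| by
      have h : (QuotientGroup.mk' C) ⁅conjPow x y (i : ℕ), conjPow x y (j : ℕ)⁆ = 1 :=
        (QuotientGroup.eq_one_iff _).mpr (Subgroup.subset_closure ⟨_, _, rfl⟩)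
      rwa [map_commutatorElement] at h)
  have hKf : K ≤ f₁.range.comap (QuotientGroup.mk' C) := by
    refine (Subgroup.closure_le _).mpr ?_
    rintro _ ⟨i, rfl⟩
    obtain ⟨a, ha⟩ := exists_fin_conjPow_eq y hx i
    rw [ha]
    exact hf₁ (Subgroup.subset_closure ⟨a, rfl⟩)
  refine ⟨fun u => zmodPowHom q x hx u.1 * ((f₁ u.2.1).out * f₂ u.2.2), fun g => ?_⟩
  have hg : g ∈ Subgroup.zpowers x ⊔ K := by
    have : (⊤ : Subgroup G) ≤ Subgroup.zpowers x ⊔ K := by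
      rw [← hgen, Subgroup.closure_le]
      rintro _ (rfl | rfl)
      · exact Subgroup.mem_sup_left (Subgroup.mem_zpowers _)
      · exact Subgroup.mem_sup_right hyK
    exact this trivial
  rw [← SetLike.mem_coe, Subgroup.mul_normal, Set.mem_mul] at hg
  obtain ⟨_, ⟨n, rfl⟩, h, hh, rfl⟩ := hg
  obtain ⟨v, hv⟩ := hKf hh
  have hout : (f₁ v).out⁻¹ * h ∈ C := by
    rw [← QuotientGroup.eq, QuotientGroup.out_eq', hv]
    rfl
  obtain ⟨w, hw⟩ := hCf hout
  refine ⟨(Multiplicative.ofAdd (1 : ZMod q) ^ n, v, w), ?_⟩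
  simp only [map_zpow, zmodPowHom_ofAdd_one, hw, mul_inv_cancel_left]

end

/-! ### The free pro-`p` group -/

/-- A basic open set constrains finitely many quotients. The kernel M of the map to their product
again has p-power index, and a word agreeing with f at M agrees at all of them. -/
theorem FreeProP.denseRange_ofFree (p : ℕ) [Fact p.Prime] : DenseRange (FreeProP.ofFree p) := by
  classical
  have hp0 : p ≠ 0 := (Fact.out : p.Prime).ne_zero
  intro f
  rw [mem_closure_iff]
  intro U hU hfU
  obtain ⟨V, hV, rfl⟩ := isOpen_induced_iff.mp hU
  obtain ⟨I, u, hu, hIV⟩ := isOpen_pi_iff.mp hV f.1 hfU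
  have hcard : ∀ N : PIndexSubgroup p, ∃ n, Nat.card (PQuotient N) = p ^ n := fun N => N.2.2
  choose n hn using hcard
  have hcardI : Nat.card (∀ N : I, PQuotient N.1) = p ^ ∑ N : I, n N.1 := by
    rw [Nat.card_pi, Finset.prod_congr rfl (fun N _ => hn N.1), Finset.prod_pow_eq_pow_sum]
  have hfin : Finite (∀ N : I, PQuotient N.1) :=
    Nat.finite_of_card_ne_zero (by rw [hcardI]; exact pow_ne_zero _ hp0)
  let g : FreeGroup (Fin 2) →* ∀ N : I, PQuotient N.1 :=
    MonoidHom.mk' (fun w N => PQuotient.mk N.1 w) (fun a b => funext fun N => map_mul (PQuotient.mk N.1) a b)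
  obtain ⟨m, hm⟩ := IsPGroup.iff_card.mp ((IsPGroup.of_card hcardI).to_subgroup g.range)
  let M : PIndexSubgroup p := ⟨g.ker, inferInstance, m, by rw [Subgroup.index_ker, hm]⟩
  obtain ⟨w, hw⟩ := QuotientGroup.mk_surjective (s := M.1) (f.1 M)
  refine ⟨FreeProP.ofFree p w, hIV fun N hN => ?_, w, rfl⟩
  have hle : M.1 ≤ N.1 := fun a ha => by
    have h := congrFun (MonoidHom.mem_ker.mp ha) ⟨N, hN⟩
    exact (QuotientGroup.eq_one_iff _).mp h
  have h : (FreeProP.ofFree p w).1 N = f.1 N := by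
    rw [← f.2 M N hle, ← hw]
    rfl
  rw [h]
  exact (hu N hN).2

theorem FreeProP.map_lift (p : ℕ) [Fact p.Prime] {P P' : Type} [Group P] [Finite P] [Group P']
    [Finite P'] (hP : IsPGroup p P) (hP' : IsPGroup p P') (f : P →* P') (a b : P)
    (g : FreeProP p) : f (FreeProP.lift p hP a b g) = FreeProP.lift p hP' (f a) (f b) g := by
  have hcomp : f.comp (FreeGroup.lift ![a, b]) = FreeGroup.lift ![f a, f b] := by
    ext i
    fin_cases i <;> simp
  have hle : (kerPIndex p hP (FreeGroup.lift ![a, b])).1 ≤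
      (kerPIndex p hP' (FreeGroup.lift ![f a, f b])).1 := by
    intro w hw
    have hw' : FreeGroup.lift ![a, b] w = 1 := hw
    change FreeGroup.lift ![f a, f b] w = 1
    rw [← hcomp, MonoidHom.comp_apply, hw', map_one]
  obtain ⟨w, hw⟩ := QuotientGroup.mk_surjective (g.1 (kerPIndex p hP (FreeGroup.lift ![a, b])))
  have h := g.2 _ _ hle
  rw [← hw] at h
  change f (QuotientGroup.kerLift (FreeGroup.lift ![a, b])
    (g.1 (kerPIndex p hP (FreeGroup.lift ![a, b])))) =
    QuotientGroup.kerLift (FreeGroup.lift ![f a, f b])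
      (g.1 (kerPIndex p hP' (FreeGroup.lift ![f a, f b])))
  rw [← h, ← hw]
  change f (FreeGroup.lift ![a, b] w) = FreeGroup.lift ![f a, f b] w
  rw [← hcomp]
  rfl

/-! ### The map from G_k to the model -/

section

variable {F Q V L : Type*} [CommRing F] [Group Q] [AddCommGroup V] [Module F V]
    [AddCommGroup L] [Module F L]

/-- The action with the form replaced by the zero form. -/
def AlternatingAction.flat (D : AlternatingAction F Q V L) : AlternatingAction F Q V PUnit.{1} where
  rho := D.rho
  sigma := 1
  form := 0
  form_self _ := rfl
  sigma_form _ _ _ := rfl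
  half := D.half
  half_add_half := D.half_add_half

/-- The projection which forgets the second component. -/
def FormExt.flatHom (D : AlternatingAction F Q V L) : FormExt D →* FormExt D.flat where
  toFun a := ⟨a.fst, PUnit.unit, a.top⟩
  map_one' := rfl
  map_mul' _ _ := rfl

theorem FormExt.isPGroup {p k : ℕ} [NeZero (p ^ k)] [Module (ZMod p) V] [Module (ZMod p) L]
    (D : AlternatingAction (ZMod p) (Multiplicative (ZMod (p ^ k))) V L) :
    IsPGroup p (FormExt D) := by
  intro g
  refine ⟨k + 1, ?_⟩
  have h : (g ^ p ^ k).top = 1 := by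
    change FormExt.topHom D (g ^ p ^ k) = 1
    rw [map_pow]
    change Multiplicative.ofAdd (p ^ k • (FormExt.topHom D g).toAdd) = 1
    rw [nsmul_eq_mul, CharP.cast_eq_zero, zero_mul, ofAdd_zero]
  rw [pow_succ, pow_mul]
  generalize g ^ p ^ k = a at h
  obtain ⟨v, w, t⟩ := a
  obtain rfl : t = 1 := h
  rw [FormExt.pow_of_top_eq_one, ← Nat.cast_smul_eq_nsmul (ZMod p),
    ← Nat.cast_smul_eq_nsmul (ZMod p), CharP.cast_eq_zero, zero_smul, zero_smul]
  rfl

end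

section

variable {p k : ℕ} [Fact p.Prime] {hp : Odd p}

instance : NeZero (p ^ k) := ⟨pow_ne_zero _ (Fact.out : p.Prime).ne_zero⟩

instance : Finite (Model p k hp) :=
  have : Finite (Multiplicative (ZMod (p ^ k))) := inferInstanceAs (Finite (ZMod (p ^ k)))
  inferInstance

instance : Finite (FormExt (modelAction p k hp).flat) :=
  have : Finite (Multiplicative (ZMod (p ^ k))) := inferInstanceAs (Finite (ZMod (p ^ k)))
  inferInstance

/-- The homomorphism from the wreath product onto the quotient of the model. -/
def WreathW.toFlat (p k : ℕ) [Fact p.Prime] (hp : Odd p) :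
    WreathW p k →* FormExt (modelAction p k hp).flat :=
  -- The inverses on j and on the top component match `Model.x`, whose top is -1.
  MonoidHom.mk' (fun g => ⟨∑ j, (g.left j).toAdd •
      (modelAction p k hp).rho j⁻¹ (unitVec p (p ^ k) 0), PUnit.unit, g.right⁻¹⟩) (by
    intro a b
    ext1
    · simp only [FormExt.mul_fst, RegularWreathProduct.mul_left, Pi.mul_apply, toAdd_mul, add_smul,
        Finset.sum_add_distrib]
      congr 1
      rw [map_sum, ← Equiv.sum_comp (Equiv.mulLeft a.right)]
      refine Finset.sum_congr rfl fun j _ => ?_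
      rw [Equiv.coe_mulLeft, inv_mul_cancel_left, mul_inv, map_mul, Module.End.mul_apply, map_smul]
      rfl
    · rfl
    · exact mul_inv _ _)

theorem WreathW.toFlat_dotX : WreathW.toFlat p k hp (WreathW.dotX p k) =
    FormExt.flatHom _ (Model.x p k hp) := by
  ext1
  · change ∑ j, _ • _ = _
    exact Finset.sum_eq_zero fun j _ => zero_smul _ _
  · rfl
  · rfl

theorem WreathW.toFlat_dotY : WreathW.toFlat p k hp (WreathW.dotY p k) =
    FormExt.flatHom _ (Model.y p k hp) := by
  ext1
  · change ∑ j, _ • _ = _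
    rw [Finset.sum_eq_single 1]
    · simp only [WreathW.dotY, Pi.mulSingle_eq_same, inv_one, map_one, toAdd_ofAdd, one_smul]
      rfl
    · intro j _ hj
      simp only [WreathW.dotY]
      rw [Pi.mulSingle_eq_of_ne hj, toAdd_one, zero_smul]
    · intro h
      exact absurd (Finset.mem_univ _) h
  · rfl
  · exact inv_one

/-- The continuous homomorphism from the free pro-`p` group to the model. -/
def FreeProP.toModel (p k : ℕ) [Fact p.Prime] (hp : Odd p) : FreeProP p →* Model p k hp :=
  FreeProP.lift p (FormExt.isPGroup _) (Model.x p k hp) (Model.y p k hp)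

/-- Both sides are lifts of the same two elements. This shows what membership in R_k or Y_k means in
the model: R_k lands in the alternating part, Y_k in trivial top. -/
theorem FreeProP.flatHom_toModel (g : FreeProP p) :
    FormExt.flatHom _ (FreeProP.toModel p k hp g) = WreathW.toFlat p k hp (etaK p k g) := by
  have h1 := FreeProP.map_lift p (FormExt.isPGroup _)
    (FormExt.isPGroup (modelAction p k hp).flat) (FormExt.flatHom _) (Model.x p k hp)
    (Model.y p k hp) g
  have h2 := FreeProP.map_lift p (WreathW.isPGroup p k)
    (FormExt.isPGroup (modelAction p k hp).flat) (WreathW.toFlat p k hp) (WreathW.dotX p k)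
    (WreathW.dotY p k) g
  rw [WreathW.toFlat_dotX, WreathW.toFlat_dotY] at h2
  exact h1.trans h2.symm

theorem FreeProP.toModel_top_of_mem_subY {g : FreeProP p} (hg : g ∈ subY p k) :
    (FreeProP.toModel p k hp g).top = 1 := by
  have h := congrArg FormExt.top (FreeProP.flatHom_toModel (hp := hp) (k := k) g)
  have hg' : (etaK p k g).right = 1 := hg
  change (FreeProP.toModel p k hp g).top = (etaK p k g).right⁻¹ at h
  rw [h, hg', inv_one]

theorem FreeProP.toModel_of_mem_subR {g : FreeProP p} (hg : g ∈ subR p k) :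
    FreeProP.toModel p k hp g = ⟨0, (FreeProP.toModel p k hp g).snd, 1⟩ := by
  have h := FreeProP.flatHom_toModel (hp := hp) (k := k) g
  have hg' : etaK p k g = 1 := hg
  rw [hg', map_one] at h
  exact FormExt.ext (congrArg FormExt.fst h :) rfl (congrArg FormExt.top h :)

theorem subN_le_ker_toModel : subN p k ≤ (FreeProP.toModel p k hp).ker := by
  refine Subgroup.topologicalClosure_minimal _ (sup_le (sup_le ?_ ?_) ?_) ?_
  · rw [Subgroup.commutator_le]
    intro r hr u hu
    have hu' := FreeProP.toModel_top_of_mem_subY (hp := hp) hu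
    rw [MonoidHom.mem_ker, map_commutatorElement, FreeProP.toModel_of_mem_subR hr,
      FormExt.commutatorElement_of_top_eq_one, hu']
    ext1 <;> simp
  · refine (Subgroup.closure_le _).mpr ?_
    rintro _ ⟨h, hh, rfl⟩
    have h1 := FreeProP.toModel_top_of_mem_subY (hp := hp) hh
    rw [SetLike.mem_coe, MonoidHom.mem_ker, map_pow]
    generalize FreeProP.toModel p k hp h = a at h1
    obtain ⟨v, w, t⟩ := a
    obtain rfl : t = 1 := h1
    rw [FormExt.pow_of_top_eq_one, ← Nat.cast_smul_eq_nsmul (ZMod p),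
      ← Nat.cast_smul_eq_nsmul (ZMod p), CharP.cast_eq_zero, zero_smul, zero_smul]
    rfl
  · refine Subgroup.normalClosure_le_normal ?_
    rintro _ rfl
    rw [SetLike.mem_coe, MonoidHom.mem_ker, map_pow, FreeProP.toModel, FreeProP.lift_genX, Model.x,
      FormExt.pow_of_fst_snd_eq_zero, ← ofAdd_nsmul, nsmul_eq_mul, CharP.cast_eq_zero, zero_mul]
    rfl
  -- Passing to the closure costs nothing: the kernel of a continuous map to a discrete group is
  -- closed.
  · let _ : TopologicalSpace (Model p k hp) := ⊥
    have : DiscreteTopology (Model p k hp) := ⟨rfl⟩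
    exact (isClosed_discrete {1}).preimage (FreeProP.continuous_lift p _ _ _)

/-- The homomorphism from `G_k` to the model. -/
def GroupG.toModel (p k : ℕ) [Fact p.Prime] (hp : Odd p) : GroupG p k →* Model p k hp :=
  QuotientGroup.lift _ (FreeProP.toModel p k hp) subN_le_ker_toModel

theorem GroupG.toModel_x : GroupG.toModel p k hp (GroupG.x p k) = Model.x p k hp :=
  FreeProP.lift_genX p (FormExt.isPGroup _) _ _

theorem GroupG.toModel_y : GroupG.toModel p k hp (GroupG.y p k) = Model.y p k hp :=
  FreeProP.lift_genY p (FormExt.isPGroup _) _ _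

theorem GroupG.toModel_surjective : Function.Surjective (GroupG.toModel p k hp) := by
  rw [← MonoidHom.range_eq_top, eq_top_iff, ← Model.closure_x_y, Subgroup.closure_le]
  rintro _ (rfl | rfl)
  · exact ⟨_, GroupG.toModel_x⟩
  · exact ⟨_, GroupG.toModel_y⟩

theorem GroupG.mk_eq_one {g : FreeProP p}
    (hg : g ∈ ⁅subR p k, subY p k⁆ ⊔ powSubgroup (subY p k) p ⊔
    Subgroup.normalClosure {FreeProP.genX p ^ p ^ k}) : (QuotientGroup.mk g : GroupG p k) = 1 :=
  (QuotientGroup.eq_one_iff _).mpr (Subgroup.le_topologicalClosure _ hg)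

theorem GroupG.x_pow : GroupG.x p k ^ p ^ k = 1 :=
  GroupG.mk_eq_one (Subgroup.mem_sup_right (Subgroup.subset_normalClosure rfl))

theorem GroupG.pow_eq_one {h : GroupG p k}
    (hh : h ∈ (subY p k).map (QuotientGroup.mk' (subN p k))) : h ^ p = 1 := by
  obtain ⟨g, hg, rfl⟩ := hh
  exact GroupG.mk_eq_one (Subgroup.mem_sup_left (Subgroup.mem_sup_right
    (Subgroup.subset_closure ⟨g, hg, rfl⟩)))

open scoped commutatorElement in
theorem commutatorElement_mem_subR {a b : FreeProP p} (ha : a ∈ subY p k) (hb : b ∈ subY p k) :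
    ⁅a, b⁆ ∈ subR p k := by
  have ha' : (etaK p k a).right = 1 := ha
  have hb' : (etaK p k b).right = 1 := hb
  rw [subR, MonoidHom.mem_ker, map_commutatorElement, commutatorElement_eq_one_iff_mul_comm]
  ext1
  · simp [ha', hb', mul_comm]
  · simp [ha', hb']

open scoped commutatorElement in
theorem GroupG.commutatorElement_eq_one {a b c : GroupG p k}
    (ha : a ∈ (subY p k).map (QuotientGroup.mk' (subN p k)))
    (hb : b ∈ (subY p k).map (QuotientGroup.mk' (subN p k)))
    (hc : c ∈ (subY p k).map (QuotientGroup.mk' (subN p k))) : ⁅⁅a, b⁆, c⁆ = 1 := by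
  obtain ⟨a, ha, rfl⟩ := ha
  obtain ⟨b, hb, rfl⟩ := hb
  obtain ⟨c, hc, rfl⟩ := hc
  rw [← map_commutatorElement, ← map_commutatorElement]
  exact GroupG.mk_eq_one (Subgroup.mem_sup_left (Subgroup.mem_sup_left
    (Subgroup.commutator_mem_commutator (commutatorElement_mem_subR ha hb) hc)))

theorem GroupG.y_mem : GroupG.y p k ∈ (subY p k).map (QuotientGroup.mk' (subN p k)) := by
  refine ⟨FreeProP.genY p, ?_, rfl⟩
  rw [SetLike.mem_coe, subY, Subgroup.mem_comap, etaK, FreeProP.lift_genY]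
  rfl

/-- The bound is applied to the abstract subgroup generated by x and y, since it is not yet known to
be all of G_k. -/
theorem GroupG.closure_exists_surjective :
    ∃ f : Multiplicative (ZMod (p ^ k)) × (Fin (p ^ k) → Multiplicative (ZMod p)) ×
      ({ij : Fin (p ^ k) × Fin (p ^ k) // ij.1 < ij.2} → Multiplicative (ZMod p)) →
        Subgroup.closure {GroupG.x p k, GroupG.y p k}, Function.Surjective f := by
  set Γ := Subgroup.closure {GroupG.x p k, GroupG.y p k} with hΓ
  have hxΓ : GroupG.x p k ∈ Γ := Subgroup.subset_closure (by simp)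
  have hyΓ : GroupG.y p k ∈ Γ := Subgroup.subset_closure (by simp)
  have : NeZero p := ⟨(Fact.out : p.Prime).ne_zero⟩
  have hH : ((subY p k).map (QuotientGroup.mk' (subN p k))).Normal :=
    Subgroup.Normal.map inferInstance _ (QuotientGroup.mk'_surjective _)
  refine exists_surjective_of_generators (x := ⟨_, hxΓ⟩) (y := ⟨_, hyΓ⟩) ?_
    (((subY p k).map (QuotientGroup.mk' (subN p k))).subgroupOf Γ) GroupG.y_mem
    (Subtype.ext GroupG.x_pow) (fun h hh => Subtype.ext (GroupG.pow_eq_one hh))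
    (fun a ha b hb c hc => Subtype.ext (GroupG.commutatorElement_eq_one ha hb hc))
  convert Subgroup.closure_closure_coe_preimage (k := {GroupG.x p k, GroupG.y p k}) using 2
  ext g
  simp [Subtype.ext_iff]

/-- The subgroup is finite, hence closed as points of G_k are closed; it contains the dense image of
the discrete free group. -/
theorem GroupG.closure_x_y : Subgroup.closure {GroupG.x p k, GroupG.y p k} = ⊤ := by
  set Γ := Subgroup.closure {GroupG.x p k, GroupG.y p k} with hΓ
  obtain ⟨f, hf⟩ := GroupG.closure_exists_surjective (p := p) (k := k)
  have : Finite (Multiplicative (ZMod (p ^ k))) := inferInstanceAs (Finite (ZMod (p ^ k)))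
  have : Finite (Multiplicative (ZMod p)) := inferInstanceAs (Finite (ZMod p))
  have hfin : Finite Γ := Finite.of_surjective f hf
  have hN : IsClosed (subN p k : Set (FreeProP p)) := Subgroup.isClosed_topologicalClosure _
  have hT1 : T1Space (GroupG p k) := inferInstance
  have hclosed : IsClosed (Γ : Set (GroupG p k)) := (Set.toFinite _).isClosed
  have hdense : DenseRange ((QuotientGroup.mk : FreeProP p → GroupG p k) ∘ FreeProP.ofFree p) :=
    QuotientGroup.mk_surjective.denseRange.comp (FreeProP.denseRange_ofFree p)
      QuotientGroup.continuous_mk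
  have hle : ((QuotientGroup.mk' (subN p k)).comp (FreeProP.ofFree p)).range ≤ Γ := by
    rw [MonoidHom.range_eq_map, ← FreeGroup.closure_range_of, MonoidHom.map_closure,
      Subgroup.closure_le]
    rintro _ ⟨_, ⟨i, rfl⟩, rfl⟩
    fin_cases i
    · exact Subgroup.subset_closure (Or.inl rfl)
    · exact Subgroup.subset_closure (Or.inr rfl)
  rw [eq_top_iff]
  intro g _
  have hg := closure_mono (show Set.range _ ⊆ (Γ : Set (GroupG p k)) from hle) (hdense g)
  rwa [hclosed.closure_eq] at hg

theorem GroupG.toModel_bijective : Function.Bijective (GroupG.toModel p k hp) := by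
  obtain ⟨f, hf⟩ := GroupG.closure_exists_surjective (p := p) (k := k)
  have : Finite (Multiplicative (ZMod (p ^ k))) := inferInstanceAs (Finite (ZMod (p ^ k)))
  have : Finite (Multiplicative (ZMod p)) := inferInstanceAs (Finite (ZMod p))
  have hval : Function.Surjective
      (Subtype.val : Subgroup.closure {GroupG.x p k, GroupG.y p k} → GroupG p k) := fun g =>
    ⟨⟨g, by rw [GroupG.closure_x_y]; trivial⟩, rfl⟩
  have hfin : Finite (GroupG p k) := Finite.of_surjective _ (hval.comp hf)
  refine GroupG.toModel_surjective.bijective_of_nat_card_le ?_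
  refine (Nat.card_le_card_of_surjective _ (hval.comp hf)).trans ?_
  -- The parameters of the normal form embed in the model, the commutator exponents becoming the
  -- entries above the diagonal. So G_k has at most as many elements as the model, and the
  -- surjection is bijective.
  refine Nat.card_le_card_of_injective (fun u => (⟨fun i => (u.2.1 i).toAdd,
    ⟨Matrix.of fun i j => if h : i < j then (u.2.2 ⟨(i, j), h⟩).toAdd else
      if h : j < i then -(u.2.2 ⟨(j, i), h⟩).toAdd else 0, ?_⟩, u.1⟩ : Model p k hp)) ?_
  · change Matrix.transpose _ = -_
    ext i j
    simp only [Matrix.transpose_apply, Matrix.of_apply, Matrix.neg_apply]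
    rcases lt_trichotomy i j with h | rfl | h
    · simp [h, h.not_gt]
    · simp
    · simp [h, h.not_gt]
  · rintro ⟨n, v, c⟩ ⟨n', v', c'⟩ h
    refine Prod.ext (congrArg FormExt.top h :) (Prod.ext (congrArg FormExt.fst h :) ?_)
    funext ⟨⟨i, j⟩, hij⟩
    have h1 := congrFun (congrFun (congrArg Subtype.val (congrArg FormExt.snd h :)) i) j
    simp only [Matrix.of_apply] at h1
    rw [dif_pos hij, dif_pos hij] at h1
    exact h1

end

/-! ### The lower central series of `G_k` -/

theorem map_rcomm {G H : Type*} [Group G] [Group H] (f : G →* H) (a b : G) :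
    f (rcomm a b) = rcomm (f a) (f b) := by
  simp [rcomm]

theorem map_iterComm {G H : Type*} [Group G] [Group H] (f : G →* H) (a b : G) (n : ℕ) :
    f (iterComm a b n) = iterComm (f a) (f b) n := by
  induction n with
  | zero => rfl
  | succ n ih => rw [iterComm, map_rcomm, ih, iterComm]

theorem Subgroup.comap_lowerCentralSeries_mulEquiv {G H : Type*} [Group G] [Group H] (e : G ≃* H)
    (n : ℕ) : ((⊤ : Subgroup H).lowerCentralSeries n).comap e.toMonoidHom =
      (⊤ : Subgroup G).lowerCentralSeries n := by
  have h := Subgroup.map_lowerCentralSeries (⊤ : Subgroup G) e.toMonoidHom n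
  rw [Subgroup.map_top_of_surjective _ e.surjective] at h
  rw [← h]
  exact Subgroup.comap_map_eq_self_of_injective e.injective _

section

variable {p k : ℕ} [Fact p.Prime]

/-- The isomorphism of `G_k` with the model. -/
noncomputable def GroupG.equivModel (p k : ℕ) [Fact p.Prime] (hp : Odd p) :
    GroupG p k ≃* Model p k hp :=
  MulEquiv.ofBijective (GroupG.toModel p k hp) GroupG.toModel_bijective

theorem GroupG.gammaTerm_eq_comap (hp : Odd p) {i : ℕ} (hi : 2 ≤ i) :
    gammaTerm (GroupG p k) i = (Model.series p k hp i).comap (GroupG.toModel p k hp) := by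
  rw [← Model.gammaTerm_eq hi]
  exact (Subgroup.comap_lowerCentralSeries_mulEquiv (GroupG.equivModel p k hp) (i - 1)).symm

theorem GroupG.toModel_c (hp : Odd p) (i : ℕ) : GroupG.toModel p k hp (GroupG.c p k i) =
    iterComm (Model.y p k hp) (Model.x p k hp) (i - 1) := by
  rw [GroupG.c, map_iterComm, GroupG.toModel_x, GroupG.toModel_y]

theorem GroupG.toModel_cc (hp : Odd p) (i j : ℕ) : GroupG.toModel p k hp (GroupG.cc p k i j) =
    iterComm (rcomm (iterComm (Model.y p k hp) (Model.x p k hp) (i - 1)) (Model.y p k hp))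
      (Model.x p k hp) (j - 1) := by
  rw [GroupG.cc, map_iterComm, map_rcomm, GroupG.toModel_c, GroupG.toModel_x, GroupG.toModel_y]

theorem GroupG.c_mem_gammaTerm (i : ℕ) : GroupG.c p k i ∈ gammaTerm (GroupG p k) i :=
  iterComm_mem_gammaTerm _ _ i

theorem GroupG.cc_mem_gammaTerm {m j : ℕ} (hm : 1 ≤ m) (hj : 1 ≤ j) :
    GroupG.cc p k m j ∈ gammaTerm (GroupG p k) (m + j) :=
  iterComm_rcomm_mem_gammaTerm _ _ hm hj

theorem gammaTerm_succ_le (G : Type*) [Group G] (i : ℕ) : gammaTerm G (i + 1) ≤ gammaTerm G i :=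
  Subgroup.lowerCentralSeries_antitone _ (Nat.sub_le_sub_right (Nat.le_succ i) 1)

/-- A set of elements of a term of the lower central series, which contains the relevant iterated
commutators, generates it modulo the next term. -/
theorem GroupG.gammaTerm_eq_closure_sup (hp : Odd p) {i : ℕ} (hi : 2 ≤ i) (S : Set (GroupG p k))
    (hS : S ⊆ gammaTerm (GroupG p k) i) (hc : i ≤ p ^ k → GroupG.c p k i ∈ S)
    (hcc : ∀ m j, Even m → 2 ≤ m → m < p ^ k → 1 ≤ j → j ≤ p ^ k → m + j = i →
      GroupG.cc p k m j ∈ S) :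
    gammaTerm (GroupG p k) i = Subgroup.closure S ⊔ gammaTerm (GroupG p k) (i + 1) := by
  refine le_antisymm ?_ (sup_le ((Subgroup.closure_le _).mpr hS) (gammaTerm_succ_le _ i))
  set K := Subgroup.closure S ⊔ gammaTerm (GroupG p k) (i + 1) with hK
  have hSK : ∀ g ∈ S, g ∈ K := fun g hg => Subgroup.mem_sup_left (Subgroup.subset_closure hg)
  have hle : Model.series p k hp i ≤ K.map (GroupG.toModel p k hp) := by
    refine Model.series_le i hi _ ?_ (fun h => ?_) (fun m j h1 h2 h3 h4 h5 h6 => ?_)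
    · intro a ha
      obtain ⟨g, rfl⟩ := GroupG.toModel_surjective a
      refine ⟨g, Subgroup.mem_sup_right ?_, rfl⟩
      rw [GroupG.gammaTerm_eq_comap hp (by omega)]
      exact ha
    · rw [← GroupG.toModel_c]
      exact Subgroup.mem_map_of_mem _ (hSK _ (hc h))
    · rw [← GroupG.toModel_cc]
      exact Subgroup.mem_map_of_mem _ (hSK _ (hcc m j h1 h2 h3 h4 h5 h6))
  rw [GroupG.gammaTerm_eq_comap hp hi]
  refine (Subgroup.comap_mono hle).trans ?_
  rw [Subgroup.comap_map_eq_self_of_injective GroupG.toModel_bijective.1]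

theorem GroupG.isElemAbelianOfRank (hp : Odd p) {i r : ℕ} (hi : 2 ≤ i)
    (h : ∃ F : Model.series p k hp i →* (Fin r → Multiplicative (ZMod p)),
      Function.Surjective F ∧ ∀ g, F g = 1 ↔ g.1 ∈ Model.series p k hp (i + 1)) :
    IsElemAbelianOfRank p (gammaFactor (GroupG p k) i) r := by
  obtain ⟨F, hF, hker⟩ := h
  have hmem : ∀ g : gammaTerm (GroupG p k) i,
      (GroupG.toModel p k hp) g.1 ∈ Model.series p k hp i := by
    rintro ⟨g, hg⟩
    rw [GroupG.gammaTerm_eq_comap hp hi] at hg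
    exact hg
  let f : gammaTerm (GroupG p k) i →* Model.series p k hp i :=
    ((GroupG.toModel p k hp).comp (gammaTerm (GroupG p k) i).subtype).codRestrict _ hmem
  have hf : Function.Surjective f := by
    rintro ⟨a, ha⟩
    obtain ⟨g, rfl⟩ := GroupG.toModel_surjective a
    exact ⟨⟨g, by rw [GroupG.gammaTerm_eq_comap hp hi]; exact ha⟩, rfl⟩
  have hkerf : (gammaTerm (GroupG p k) (i + 1)).subgroupOf (gammaTerm (GroupG p k) i) =
      (F.comp f).ker := by
    ext g
    rw [Subgroup.mem_subgroupOf, MonoidHom.mem_ker, MonoidHom.comp_apply, hker,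
      GroupG.gammaTerm_eq_comap hp (by omega)]
    rfl
  exact ⟨(QuotientGroup.quotientMulEquivOfEq hkerf).trans
    (QuotientGroup.quotientKerEquivOfSurjective (F.comp f) (hF.comp hf))⟩

theorem GroupG.nilpotencyClass_eq (hp : Odd p) (hk : 1 ≤ k) :
    Group.IsNilpotent (GroupG p k) ∧ Group.nilpotencyClass (GroupG p k) = 2 * p ^ k - 1 := by
  have hq : 2 ≤ p ^ k := (Fact.out : p.Prime).two_le.trans (Nat.le_self_pow (by omega) p)
  have hbot : (⊤ : Subgroup (GroupG p k)).lowerCentralSeries (2 * p ^ k - 1) = ⊥ := by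
    have h := GroupG.gammaTerm_eq_comap (k := k) hp (i := 2 * p ^ k) (by omega)
    rw [Model.series_eq_bot] at h
    refine h.trans ?_
    exact (MonoidHom.ker_eq_bot_iff _).mpr GroupG.toModel_bijective.1
  have hnil : Group.IsNilpotent (GroupG p k) :=
    Subgroup.nilpotent_iff_lowerCentralSeries.mpr ⟨_, hbot⟩
  refine ⟨hnil, le_antisymm
    (Subgroup.lowerCentralSeries_eq_bot_iff_nilpotencyClass_le.mp hbot) ?_⟩
  by_contra hlt
  have h1 : (⊤ : Subgroup (GroupG p k)).lowerCentralSeries (2 * p ^ k - 1 - 1) = ⊥ :=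
    Subgroup.lowerCentralSeries_eq_bot_iff_nilpotencyClass_le.mpr (by omega)
  have h2 := GroupG.gammaTerm_eq_comap (k := k) hp (i := 2 * p ^ k - 1) (by omega)
  refine Model.series_ne_bot (p := p) (hp := hp) hk ?_
  rw [eq_bot_iff]
  intro a ha
  obtain ⟨g, rfl⟩ := GroupG.toModel_surjective a
  have hg : g ∈ gammaTerm (GroupG p k) (2 * p ^ k - 1) := by
    rw [h2]
    exact ha
  rw [gammaTerm, h1, Subgroup.mem_bot] at hg
  rw [hg, map_one]
  exact Subgroup.one_mem _

end

theorem proposition3p4 (p : ℕ) [Fact p.Prime] (hp : Odd p) (k : ℕ) (hk : 1 ≤ k) :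
    -- the nilpotency class
    (Group.IsNilpotent (GroupG p k) ∧ Group.nilpotencyClass (GroupG p k) = 2 * p ^ k - 1) ∧
    -- the first factor
    (gammaTerm (GroupG p k) 1 = ⊤ ∧
      gammaTerm (GroupG p k) 1 =
        Subgroup.closure {GroupG.x p k, GroupG.y p k} ⊔ gammaTerm (GroupG p k) 2 ∧
      Nonempty (GroupG p k ⧸ gammaTerm (GroupG p k) 2 ≃*
        Multiplicative (ZMod (p ^ k)) × Multiplicative (ZMod p))) ∧
    -- `2 ≤ i ≤ p ^ k`, `i` even
    (∀ i : ℕ, 2 ≤ i → i ≤ p ^ k → Even i →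
      gammaTerm (GroupG p k) i =
        Subgroup.closure ({GroupG.c p k i} ∪
          {g | ∃ m j : ℕ, Even m ∧ 2 ≤ m ∧ 2 ≤ j ∧ m + j = i ∧ g = GroupG.cc p k m j}) ⊔
        gammaTerm (GroupG p k) (i + 1) ∧
      IsElemAbelianOfRank p (gammaFactor (GroupG p k) i) (i / 2)) ∧
    -- `2 ≤ i ≤ p ^ k`, `i` odd
    (∀ i : ℕ, 2 ≤ i → i ≤ p ^ k → Odd i →
      gammaTerm (GroupG p k) i =
        Subgroup.closure ({GroupG.c p k i} ∪
          {g | ∃ m j : ℕ, Even m ∧ 2 ≤ m ∧ 1 ≤ j ∧ m + j = i ∧ g = GroupG.cc p k m j}) ⊔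
        gammaTerm (GroupG p k) (i + 1) ∧
      IsElemAbelianOfRank p (gammaFactor (GroupG p k) i) ((i + 1) / 2)) ∧
    -- `p ^ k + 1 ≤ i ≤ 2 * p ^ k - 1`, `i` even
    (∀ i : ℕ, p ^ k + 1 ≤ i → i ≤ 2 * p ^ k - 1 → Even i →
      gammaTerm (GroupG p k) i =
        Subgroup.closure
          {g | ∃ m j : ℕ, Even m ∧ m ≤ p ^ k - 1 ∧ j ≤ p ^ k - 1 ∧ m + j = i ∧
            g = GroupG.cc p k m j} ⊔
        gammaTerm (GroupG p k) (i + 1) ∧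
      IsElemAbelianOfRank p (gammaFactor (GroupG p k) i) ((2 * p ^ k - i) / 2)) ∧
    -- `p ^ k + 1 ≤ i ≤ 2 * p ^ k - 1`, `i` odd
    (∀ i : ℕ, p ^ k + 1 ≤ i → i ≤ 2 * p ^ k - 1 → Odd i →
      gammaTerm (GroupG p k) i =
        Subgroup.closure
          {g | ∃ m j : ℕ, Even m ∧ m ≤ p ^ k - 1 ∧ j ≤ p ^ k ∧ m + j = i ∧
            g = GroupG.cc p k m j} ⊔
        gammaTerm (GroupG p k) (i + 1) ∧
      IsElemAbelianOfRank p (gammaFactor (GroupG p k) i) ((2 * p ^ k - i + 1) / 2)) := by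
  have hq : 2 ≤ p ^ k := (Fact.out : p.Prime).two_le.trans (Nat.le_self_pow (by omega) p)
  obtain ⟨u, hu⟩ : Odd (p ^ k) := hp.pow
  refine ⟨GroupG.nilpotencyClass_eq hp hk, ⟨rfl, ?_, ?_⟩, ?_, ?_, ?_, ?_⟩
  · rw [GroupG.closure_x_y, top_sup_eq]
    rfl
  · have hker : gammaTerm (GroupG p k) 2 =
        ((Model.abHom p k hp).comp (GroupG.toModel p k hp)).ker := by
      rw [GroupG.gammaTerm_eq_comap hp le_rfl, ← Model.ker_abHom]
      rfl
    exact ⟨(QuotientGroup.quotientMulEquivOfEq hker).trans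
      (QuotientGroup.quotientKerEquivOfSurjective _
        (Model.abHom_surjective.comp GroupG.toModel_surjective))⟩
  · rintro i hi hik ⟨n, hn⟩
    refine ⟨GroupG.gammaTerm_eq_closure_sup hp hi _ ?_ (fun _ => Or.inl rfl) ?_, ?_⟩
    · rintro _ (rfl | ⟨m, j, -, hm, hj, rfl, rfl⟩)
      · exact GroupG.c_mem_gammaTerm i
      · exact GroupG.cc_mem_gammaTerm (by omega) (by omega)
    · rintro m j ⟨m', hm'⟩ hm - hj - hmj
      -- As i and m are even, so is j, hence j ≥ 2.
      exact Or.inr ⟨m, j, ⟨m', hm'⟩, hm, by omega, hmj, rfl⟩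
    · rw [show i / 2 = (i + 1) / 2 by omega]
      exact GroupG.isElemAbelianOfRank hp hi (Model.exists_hom_low hi hik)
  · intro i hi hik _
    refine ⟨GroupG.gammaTerm_eq_closure_sup hp hi _ ?_ (fun _ => Or.inl rfl) ?_,
      GroupG.isElemAbelianOfRank hp hi (Model.exists_hom_low hi hik)⟩
    · rintro _ (rfl | ⟨m, j, -, hm, hj, rfl, rfl⟩)
      · exact GroupG.c_mem_gammaTerm i
      · exact GroupG.cc_mem_gammaTerm (by omega) hj
    · intro m j hme hm _ hj _ hmj
      exact Or.inr ⟨m, j, hme, hm, hj, hmj, rfl⟩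
  · rintro i hik hi2 ⟨n, hn⟩
    refine ⟨GroupG.gammaTerm_eq_closure_sup hp (by omega) _ ?_ (fun h => by omega) ?_, ?_⟩
    · rintro _ ⟨m, j, -, hm, hj, rfl, rfl⟩
      -- Both indices are positive because each is at most q-1 while their sum exceeds q.
      exact GroupG.cc_mem_gammaTerm (by omega) (by omega)
    · rintro m j ⟨m', hm'⟩ hm hmq hj hjq hmj
      -- Here j is even and q is odd, so j ≤ q improves to j ≤ q-1.
      exact ⟨m, j, ⟨m', hm'⟩, by omega, by omega, hmj, rfl⟩
    · rw [show (2 * p ^ k - i) / 2 = (2 * p ^ k - i + 1) / 2 by omega]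
      exact GroupG.isElemAbelianOfRank hp (by omega) (Model.exists_hom_high hik hk)
  · intro i hik hi2 _
    refine ⟨GroupG.gammaTerm_eq_closure_sup hp (by omega) _ ?_ (fun h => by omega) ?_,
      GroupG.isElemAbelianOfRank hp (by omega) (Model.exists_hom_high hik hk)⟩
    · rintro _ ⟨m, j, -, hm, hj, rfl, rfl⟩
      exact GroupG.cc_mem_gammaTerm (by omega) (by omega)
    · intro m j hme hm hmq hj hjq hmj
      exact ⟨m, j, hme, by omega, hjq, hmj, rfl⟩
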